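/- All manifolds are smooth, finite-dimensional, Hausdorff and without boundary. Let $\pi\colon C\to B$ be a smooth fibration, i.e. a smooth locally trivial fibre bundle, with compact typical fibre. Let $\alpha$ be a contact form on $C$: a smooth $1$-form, nowhere zero, such that $d\alpha$ is nondegenerate on $D=\ker\alpha$. Assume that the fibres are contact submanifolds: for each $p\in C$, with $T_pF=\ker d_p\pi$, the form $\alpha_p$ does not vanish identically on $T_pF$, and $d\alpha_p$ is nondegenerate on $T_pF\cap D_p$. The associated contact connection is the distribution $$H=(TF\cap D)^{\perp d\alpha}=\{v\in D:\ d\alpha(v,w)=0\ \text{ for all } w\in TF\cap D\}\subset D .$$ (1) Let $1\le k\le\infty$, let $\gamma\colon[0,1]\to B$ be a path of class $C^k$, and let $p_0\in C$ with $\pi(p_0)=\gamma(0)$. Then there is a path $\tilde\gamma_{p_0}\colon[0,1]\to C$ of class $C^k$ such that * $\tilde\gamma_{p_0}(0)=p_0$, * $\pi\circ\tilde\gamma_{p_0}=\gamma$, * $\tilde\gamma_{p_0}'(t)\in H_{\tilde\gamma_{p_0}(t)}$ for all $t\in[0,1]$, and it is the only differentiable path $[0,1]\to C$ with these three properties. (2)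 If $\gamma\colon[0,1]\to B$ is a smooth immersed path, then the monodromy map $$m\colon F_0=\pi^{-1}(\gamma(0))\to F_1=\pi^{-1}(\gamma(1)),\qquad m(p)=\tilde\gamma_p(1),$$ is a contactomorphism: it is a diffeomorphism, and $dm$ maps the contact structure $TF_0\cap D$ of $F_0$ onto the contact structure $TF_1\cap D$ of $F_1$. -/

import Mathlib

open Set Bundle
open scoped Manifold ContDiff Topology

noncomputable section

/-- A (not necessarily continuous) `1`-form on a manifold `M` modelled on the vector space `E`. -/
abbrev OneForm (E : Type*) [NormedAddCommGroup E] [NormedSpace ℝ E]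
    (M : Type*) [TopologicalSpace M] [ChartedSpace E M] : Type _ :=
  ∀ p : M, TangentSpace 𝓘(ℝ, E) p →L[ℝ] ℝ

section Forms

variable {E : Type*} [NormedAddCommGroup E] [NormedSpace ℝ E]
  {M : Type*} [TopologicalSpace M] [ChartedSpace E M]

/-- The `1`-form is a smooth section of the cotangent bundle. -/
def OneForm.IsSmooth [IsManifold 𝓘(ℝ, E) ∞ M] (α : OneForm E M) : Prop :=
  haveI : IsManifold 𝓘(ℝ, E) 1 M := IsManifold.of_le (n := ∞) (by norm_cast)
  ContMDiff 𝓘(ℝ, E) (𝓘(ℝ, E).prod 𝓘(ℝ, E →L[ℝ] ℝ)) ∞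
    (fun p : M ↦ TotalSpace.mk' (E →L[ℝ] ℝ) (E := fun p : M ↦ TangentSpace 𝓘(ℝ, E) p →L[ℝ] ℝ)
      p (α p))

/-- The `1`-form read in the preferred chart `φ` at `p`, that is the form `(φ⁻¹)^* α` on (an open
subset of) the model space `E`. -/
def OneForm.inChart (α : OneForm E M) (p : M) (y : E) : E [⋀^Fin 1]→L[ℝ] ℝ :=
  ContinuousAlternatingMap.ofSubsingleton ℝ E ℝ (0 : Fin 1)
    ((α ((extChartAt 𝓘(ℝ, E) p).symm y)).comp
      (mfderiv 𝓘(ℝ, E) 𝓘(ℝ, E) (extChartAt 𝓘(ℝ, E) p).symm y))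

/-- The exterior derivative `dα` of a `1`-form: `φ^* d((φ⁻¹)^* α)` at `p`, where `φ` is the
preferred chart at `p`. -/
def OneForm.d (α : OneForm E M) (p : M) : TangentSpace 𝓘(ℝ, E) p [⋀^Fin 2]→L[ℝ] ℝ :=
  (extDeriv (α.inChart p) (extChartAt 𝓘(ℝ, E) p p)).compContinuousLinearMap
    (mfderiv 𝓘(ℝ, E) 𝓘(ℝ, E) (extChartAt 𝓘(ℝ, E) p) p)

/-- The form `α`, restricted to the subspace `V` of the tangent space at `p`, is a linear contact
form: it does not vanish on `V`, and `dα` is nondegenerate on `V ∩ ker α`. -/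
def OneForm.IsContactOn (α : OneForm E M) (p : M) (V : Submodule ℝ (TangentSpace 𝓘(ℝ, E) p)) :
    Prop :=
  (∃ v ∈ V, α p v ≠ 0) ∧
    ∀ v ∈ V, α p v = 0 → (∀ w ∈ V, α p w = 0 → α.d p ![v, w] = 0) → v = 0

/-- `α` is a contact form on `M`: it is smooth, nowhere zero, and `dα` is nondegenerate on the
hyperplane field `D = ker α`. -/
structure OneForm.IsContactForm [IsManifold 𝓘(ℝ, E) ∞ M] (α : OneForm E M) : Prop where
  smooth : α.IsSmooth
  contact : ∀ p : M, α.IsContactOn p ⊤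

end Forms

section Fibrations

variable {EC : Type*} [NormedAddCommGroup EC] [NormedSpace ℝ EC]
  {C : Type*} [TopologicalSpace C] [ChartedSpace EC C]
  {EB : Type*} [NormedAddCommGroup EB] [NormedSpace ℝ EB]
  {B : Type*} [TopologicalSpace B] [ChartedSpace EB B]
  (EF : Type*) [NormedAddCommGroup EF] [NormedSpace ℝ EF]
  {F : Type*} [TopologicalSpace F] [ChartedSpace EF F]

/-- A local trivialization `pr⁻¹(U) ≃ U × F` that is a diffeomorphism. -/
structure IsSmoothTrivialization {pr : C → B} (e : Trivialization F pr) : Prop where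
  contMDiffOn_toFun :
    ContMDiffOn 𝓘(ℝ, EC) (𝓘(ℝ, EB).prod 𝓘(ℝ, EF)) ∞ e e.source
  contMDiffOn_invFun :
    ContMDiffOn (𝓘(ℝ, EB).prod 𝓘(ℝ, EF)) 𝓘(ℝ, EC) ∞ e.toOpenPartialHomeomorph.symm e.target

variable (F) in
/-- `pr : C → B` is a smooth fibration (a smooth locally trivial fibre bundle) with typical
fibre `F`. -/
structure IsSmoothFibration (pr : C → B) : Prop where
  contMDiff : ContMDiff 𝓘(ℝ, EC) 𝓘(ℝ, EB) ∞ pr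
  locallyTrivial : ∀ b : B, ∃ e : Trivialization F pr, b ∈ e.baseSet ∧
    IsSmoothTrivialization (EC := EC) (EB := EB) EF e

variable {EF}

/-- The manifold structure of the fibre `pr⁻¹(b)`: its charts are the homeomorphisms
`pr⁻¹(b) ≃ F` given by the smooth local trivializations around `b`, followed by the charts
of `F`. -/
@[reducible]
def IsSmoothFibration.fibreChartedSpace {pr : C → B}
    (h : IsSmoothFibration (EC := EC) (EB := EB) EF F pr) (b : B) :
    ChartedSpace EF (pr ⁻¹' {b}) where
  atlas := {φ | ∃ (e : Trivialization F pr) (hb : b ∈ e.baseSet),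
    IsSmoothTrivialization (EC := EC) (EB := EB) EF e ∧ ∃ c ∈ atlas EF F,
      φ = (e.preimageSingletonHomeomorph hb).toOpenPartialHomeomorph.trans c}
  chartAt p := ((h.locallyTrivial b).choose.preimageSingletonHomeomorph
      (h.locallyTrivial b).choose_spec.1).toOpenPartialHomeomorph.trans
    (chartAt EF ((h.locallyTrivial b).choose.preimageSingletonHomeomorph
      (h.locallyTrivial b).choose_spec.1 p))
  mem_chart_source p := by simp
  chart_mem_atlas p := ⟨_, (h.locallyTrivial b).choose_spec.1, (h.locallyTrivial b).choose_spec.2,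
    _, chart_mem_atlas _ _, rfl⟩

/-- The transition map between two smooth trivializations over the same fibre is smooth. -/
theorem IsSmoothTrivialization.contMDiff_transition {pr : C → B} {b : B} {e e' : Trivialization F pr}
    (he : IsSmoothTrivialization (EC := EC) (EB := EB) EF e)
    (he' : IsSmoothTrivialization (EC := EC) (EB := EB) EF e')
    (hb : b ∈ e.baseSet) (hb' : b ∈ e'.baseSet) :
    ContMDiff 𝓘(ℝ, EF) 𝓘(ℝ, EF) ∞
      (fun x ↦ e'.preimageSingletonHomeomorph hb' ((e.preimageSingletonHomeomorph hb).symm x)) := by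
  have h1 : ContMDiff 𝓘(ℝ, EF) 𝓘(ℝ, EC) ∞
      (fun x : F ↦ e.toOpenPartialHomeomorph.symm (b, x)) := by
    have h0 : ContMDiff 𝓘(ℝ, EF) (𝓘(ℝ, EB).prod 𝓘(ℝ, EF)) ∞ (fun x : F ↦ (b, x)) :=
      contMDiff_const.prodMk contMDiff_id
    exact he.contMDiffOn_invFun.comp_contMDiff h0 (fun x ↦ e.mem_target.2 hb)
  have h2 := he'.contMDiffOn_toFun.comp_contMDiff h1 (fun x ↦ by
    rw [e'.mem_source]
    have : pr (e.toOpenPartialHomeomorph.symm (b, x)) = b := e.proj_symm_apply' hb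
    rw [this]; exact hb')
  have h3 : ContMDiff (𝓘(ℝ, EB).prod 𝓘(ℝ, EF)) 𝓘(ℝ, EF) ∞ (Prod.snd : B × F → F) := contMDiff_snd
  exact h3.comp h2

/-- The fibres of a smooth fibration are smooth manifolds. -/
theorem IsSmoothFibration.isManifold_fibre [IsManifold 𝓘(ℝ, EF) ∞ F] {pr : C → B}
    (h : IsSmoothFibration (EC := EC) (EB := EB) EF F pr) (b : B) :
    letI := h.fibreChartedSpace b
    IsManifold 𝓘(ℝ, EF) ∞ (pr ⁻¹' {b}) := by
  let _ := h.fibreChartedSpace b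
  apply isManifold_of_contDiffOn
  rintro _ _ ⟨e, hb, he, c, hc, rfl⟩ ⟨e', hb', he', c', hc', rfl⟩
  have key := he.contMDiff_transition he' hb hb'
  have hc1 : ContMDiffOn 𝓘(ℝ, EF) 𝓘(ℝ, EF) ∞ c.symm c.target :=
    contMDiffOn_symm_of_mem_maximalAtlas (IsManifold.subset_maximalAtlas hc)
  have hc2 : ContMDiffOn 𝓘(ℝ, EF) 𝓘(ℝ, EF) ∞ c' c'.source :=
    contMDiffOn_of_mem_maximalAtlas (IsManifold.subset_maximalAtlas hc')
  have h1 := key.contMDiffOn (s := univ) |>.comp hc1 (fun x _ ↦ mem_univ _)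
  have h2 := hc2.comp (h1.mono inter_subset_left) (s := c.target ∩
    {x | e'.preimageSingletonHomeomorph hb' ((e.preimageSingletonHomeomorph hb).symm
      (c.symm x)) ∈ c'.source}) (fun x hx ↦ hx.2)
  refine (contMDiffOn_iff_contDiffOn.1 h2).mono fun x hx ↦ ?_
  have hx' := hx.1
  simpa [OpenPartialHomeomorph.trans_source] using hx'

/-- The restriction of a `1`-form on the total space to the fibre `pr⁻¹(b)`. -/
def IsSmoothFibration.fibreForm {pr : C → B}
    (h : IsSmoothFibration (EC := EC) (EB := EB) EF F pr) (α : OneForm EC C) (b : B) :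
    letI := h.fibreChartedSpace b
    OneForm EF (pr ⁻¹' {b}) :=
  letI := h.fibreChartedSpace b
  fun p ↦ (α (p : C)).comp (mfderiv 𝓘(ℝ, EF) 𝓘(ℝ, EC) (Subtype.val : pr ⁻¹' {b} → C) p)

/-- A map `m` between two fibres is a contactomorphism, for the contact structures on the fibres
given by the kernel of the restriction of `α`: it is a diffeomorphism whose differential maps the
contact hyperplane at each point `p` onto the one at `m p`. -/
def IsSmoothFibration.IsFibreContactomorphism {pr : C → B}
    (h : IsSmoothFibration (EC := EC) (EB := EB) EF F pr) (α : OneForm EC C) (b₀ b₁ : B)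
    (m : pr ⁻¹' {b₀} → pr ⁻¹' {b₁}) : Prop :=
  letI := h.fibreChartedSpace b₀
  letI := h.fibreChartedSpace b₁
  (∃ Φ : (pr ⁻¹' {b₀}) ≃ₘ^∞⟮𝓘(ℝ, EF), 𝓘(ℝ, EF)⟯ (pr ⁻¹' {b₁}), ⇑Φ = m) ∧
    ∀ p : pr ⁻¹' {b₀},
      (LinearMap.ker (h.fibreForm α b₀ p).toLinearMap).map
          (mfderiv 𝓘(ℝ, EF) 𝓘(ℝ, EF) m p).toLinearMap =
        LinearMap.ker (h.fibreForm α b₁ (m p)).toLinearMap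

/-- The vertical tangent space `T_p F = ker d_p pr`. -/
def verticalSpace (pr : C → B) (p : C) : Submodule ℝ (TangentSpace 𝓘(ℝ, EC) p) :=
  LinearMap.ker (mfderiv 𝓘(ℝ, EC) 𝓘(ℝ, EB) pr p).toLinearMap

variable (EF F) in
/-- A contact fibration: a smooth fibration whose total space carries a contact form `α`, such that
the fibres are contact submanifolds. -/
structure IsContactFibration [IsManifold 𝓘(ℝ, EC) ∞ C] (pr : C → B) (α : OneForm EC C) :
    Prop where
  fibration : IsSmoothFibration (EC := EC) (EB := EB) EF F pr
  contactForm : α.IsContactForm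
  contact_fibre : ∀ p : C, α.IsContactOn p (verticalSpace (EC := EC) (EB := EB) pr p)

variable (EB) in
/-- The contact connection `H = (TF ∩ D)^{⊥ dα} ⊆ D`, where `D = ker α`. -/
def contactConnection (pr : C → B) (α : OneForm EC C) (p : C) :
    Submodule ℝ (TangentSpace 𝓘(ℝ, EC) p) where
  carrier := {v | α p v = 0 ∧
    ∀ w ∈ verticalSpace (EC := EC) (EB := EB) pr p, α p w = 0 → α.d p ![v, w] = 0}
  zero_mem' := ⟨map_zero _, fun w _ _ ↦ (α.d p).map_coord_zero 0 rfl⟩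
  add_mem' := by
    rintro v v' ⟨h1, h2⟩ ⟨h1', h2'⟩
    refine ⟨by rw [map_add, h1, h1', add_zero], fun w hw hw' ↦ ?_⟩
    have := (α.d p).toAlternatingMap.map_vecCons_add ![w] v v'
    exact this.trans <| by
      change α.d p ![v, w] + α.d p ![v', w] = 0
      rw [h2 w hw hw', h2' w hw hw', add_zero]
  smul_mem' := by
    rintro r v ⟨h1, h2⟩
    refine ⟨by rw [map_smul, h1, smul_zero], fun w hw hw' ↦ ?_⟩
    have := (α.d p).toAlternatingMap.map_vecCons_smul ![w] r v
    exact this.trans <| by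
      change r • α.d p ![v, w] = 0
      rw [h2 w hw hw', smul_zero]

variable (EB) in
/-- `c` is a lift of the path `γ : [0,1] → B` that starts at `p₀` and is horizontal, that is
tangent to the contact connection. Only the values of `γ` and `c` on `[0,1]` matter. -/
structure IsHorizontalLift (pr : C → B) (α : OneForm EC C) (γ : ℝ → B) (p₀ : C) (c : ℝ → C) :
    Prop where
  start : c 0 = p₀
  lift : ∀ t ∈ Icc (0 : ℝ) 1, pr (c t) = γ t
  differentiable : MDifferentiableOn 𝓘(ℝ, ℝ) 𝓘(ℝ, EC) c (Icc (0 : ℝ) 1)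
  horizontal : ∀ t ∈ Icc (0 : ℝ) 1,
    mfderivWithin 𝓘(ℝ, ℝ) 𝓘(ℝ, EC) c (Icc (0 : ℝ) 1) t (1 : ℝ) ∈ contactConnection EB pr α (c t)

variable (EB) in
/-- `γ : [0,1] → B` is a smooth immersed path. -/
structure IsImmersedPath (γ : ℝ → B) : Prop where
  smooth : ContMDiffOn 𝓘(ℝ, ℝ) 𝓘(ℝ, EB) ∞ γ (Icc (0 : ℝ) 1)
  immersed : ∀ t ∈ Icc (0 : ℝ) 1,
    mfderivWithin 𝓘(ℝ, ℝ) 𝓘(ℝ, EB) γ (Icc (0 : ℝ) 1) t (1 : ℝ) ≠ 0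

end Fibrations

end

/-! In a chart of the total space lying over a chart of the base, everything takes place on an open
set of `EB × EF`. Because `α` is a linear contact form on each vertical space, exactly one
horizontal vector lies over each base vector, so `H` is the graph of a smooth family of linear maps
`A z : EB → EF` (`exists_horizontal_graph`). A horizontal lift is then a solution of `x' = A(y, x)
y'`, where `y` is `γ` read in the chart. Local existence, uniqueness, smooth dependence on the
initial value and the variational equation come from `exists_smooth_flow`, whose coefficients are
only continuous in time, as they are when `γ` is only `C^1`. Bootstrapping in the equation makes a
lift as regular as `γ`.

A solution might leave every chart in finite time. Compactness of the typical fibre excludes this: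
near each time, one length of interval serves a whole fibre (`eventually_hasContactTransportAt`).
Connectedness of `[0,1]` then gives parallel transport between any two times. By uniqueness of
lifts, the transports from `t` to `s` and from `s` to `t` are inverse to each other, so both are
diffeomorphisms.

For the contact structures, let `h` be the horizontal velocity. The functional `dα(h, ·)` vanishes
on `TF ∩ D`, so on `TF` it equals `-r α` for a scalar `r`. If the vertical vector `w` is carried
along by the derivative of the flow, then `(α(w))' = dα(h, w) = -r α(w)`. This is a homogeneous
linear equation, so `α(w) = 0` persists (`form_eq_zero_of_variational`). The same fact for the
inverse transport shows that the contact hyperplanes are mapped onto each other. -/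

noncomputable section

/-! ### Smoothness of composition operators on spaces of continuous functions. -/

section Nemytskii

universe u

set_option synthInstance.maxHeartbeats 200000

variable {K : Type*} [TopologicalSpace K] [CompactSpace K]

/-- Pointwise application of a bilinear map to two continuous functions. -/
def ContinuousMap.bilinearComp (K : Type*) [TopologicalSpace K] [CompactSpace K] {L Z W : Type*}
    [NormedAddCommGroup L] [NormedSpace ℝ L]
    [NormedAddCommGroup Z] [NormedSpace ℝ Z] [NormedAddCommGroup W] [NormedSpace ℝ W]
    (β : L →L[ℝ] Z →L[ℝ] W) :
    C(K, L) →L[ℝ] C(K, Z) →L[ℝ] C(K, W) :=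
  LinearMap.mkContinuous₂
    (LinearMap.mk₂ ℝ (fun (A : C(K, L)) (z : C(K, Z)) ↦
      (⟨fun t ↦ β (A t) (z t), by fun_prop⟩ : C(K, W)))
      (by intros; ext; simp) (by intros; ext; simp) (by intros; ext; simp) (by intros; ext; simp))
    ‖β‖
    (fun A z ↦ by
      rw [ContinuousMap.norm_le _ (by positivity)]
      intro t
      refine (β.le_opNorm₂ _ _).trans ?_
      gcongr
      · exact A.norm_coe_le_norm t
      · exact z.norm_coe_le_norm t)

/-- The composition operator `z ↦ g ∘ z` on spaces of continuous functions has as derivative at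
`z` the multiplication by `g' ∘ z`. -/
theorem ContinuousMap.hasFDerivAt_postcomp {Z W : Type*}
    [NormedAddCommGroup Z] [NormedSpace ℝ Z] [NormedAddCommGroup W] [NormedSpace ℝ W]
    {g : C(Z, W)} {g' : C(Z, Z →L[ℝ] W)} (hg : ∀ x, HasFDerivAt g (g' x) x) (z : C(K, Z)) :
    HasFDerivAt (fun z : C(K, Z) ↦ g.comp z) (ContinuousMap.bilinearComp K (.id ℝ (Z →L[ℝ] W))
      (g'.comp z)) z := by
  refine .of_isLittleO (Asymptotics.isLittleO_iff.2 fun c hc ↦ ?_)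
  have hcont : Continuous (fun z : C(K, Z) ↦ g'.comp z) := ContinuousMap.continuous_postcomp g'
  obtain ⟨δ, hδ, hb⟩ := Metric.eventually_nhds_iff.1
    ((hcont.tendsto z).eventually (Metric.ball_mem_nhds (g'.comp z) hc))
  filter_upwards [Metric.ball_mem_nhds z hδ] with z' hz'
  rw [ContinuousMap.norm_le _ (by positivity)]
  intro t
  -- A point of the segment from `z t` to `z' t` is the value at `t` of `z + s • (z' - z)`, which is
  -- within `δ` of `z` in the sup norm. So one `δ` serves all `t`, and the mean value inequality
  -- applies.
  have key : ∀ x ∈ segment ℝ (z t) (z' t), ‖g' x - g' (z t)‖ ≤ c := by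
    rintro x hx
    rw [segment_eq_image'] at hx
    obtain ⟨s, hs, rfl⟩ := hx
    have h1 : dist (z + s • (z' - z)) z < δ := by
      rw [dist_eq_norm, add_sub_cancel_left, norm_smul, Real.norm_of_nonneg hs.1]
      rw [Metric.mem_ball, dist_eq_norm] at hz'
      exact (mul_le_of_le_one_left (norm_nonneg _) hs.2).trans_lt hz'
    have h2 := (hb h1).le
    rw [← dist_eq_norm]
    exact (ContinuousMap.dist_apply_le_dist t).trans h2
  have := (convex_segment (z t) (z' t)).norm_image_sub_le_of_norm_hasFDerivWithin_le'
    (fun x _ ↦ (hg x).hasFDerivWithinAt) key (left_mem_segment ℝ _ _) (right_mem_segment ℝ _ _)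
  refine this.trans ?_
  gcongr
  exact ContinuousMap.norm_coe_le_norm (z' - z) t

/-- The derivative is a continuous linear image of composition with `g'`, an operator of the same
kind, so induction on the order works. `Z` and `W` share a universe so that `Z →L[ℝ] W` can take the
place of `W`. -/
theorem ContinuousMap.contDiff_postcomp {Z : Type u} [NormedAddCommGroup Z] [NormedSpace ℝ Z]
    {W : Type u} [NormedAddCommGroup W] [NormedSpace ℝ W] (g : C(Z, W)) (hg : ContDiff ℝ ∞ g) :
    ContDiff ℝ ∞ (fun z : C(K, Z) ↦ g.comp z) := by
  rw [contDiff_infty]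
  intro n
  induction n generalizing W with
  | zero => exact contDiff_zero.2 (ContinuousMap.continuous_postcomp g)
  | succ n ih =>
    have hg' : ContDiff ℝ ∞ (fderiv ℝ g) := hg.fderiv_right (by norm_cast)
    have := ih ⟨fderiv ℝ g, hg'.continuous⟩ hg'
    push_cast
    refine contDiff_succ_iff_hasFDerivAt.2
      ⟨_, (ContinuousMap.bilinearComp K (.id ℝ (Z →L[ℝ] W))).contDiff.comp this, fun z ↦ ?_⟩
    exact ContinuousMap.hasFDerivAt_postcomp
      (g' := ⟨fderiv ℝ g, hg'.continuous⟩)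
      (fun x ↦ (hg.differentiable (by simp) x).hasFDerivAt) z

end Nemytskii

/-! ### Differential equations as a smooth equation in `C([a, b], E)`. -/

section Flow

theorem exists_continuousLinearEquiv_of_norm_sub_id_lt {X : Type*} [NormedAddCommGroup X]
    [NormedSpace ℝ X] [CompleteSpace X] (T : X →L[ℝ] X) (hT : ‖T - .id ℝ X‖ < 1) :
    ∃ e : X ≃L[ℝ] X, (e : X →L[ℝ] X) = T := by
  have h : ‖1 - T‖ < 1 := by
    rw [norm_sub_rev]
    exact hT
  refine ⟨ContinuousLinearEquiv.unitsEquiv ℝ X (Units.oneSub (1 - T) h), ?_⟩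
  ext v
  simp


/-- The operator `v ↦ ∫_{t₁}^t v` on continuous functions on `[a, b]`. -/
def integralOperator (E : Type*) [NormedAddCommGroup E] [NormedSpace ℝ E] [CompleteSpace E]
    {a b : ℝ} (hab : a ≤ b) (t₁ : Icc a b) : C(Icc a b, E) →L[ℝ] C(Icc a b, E) :=
  LinearMap.mkContinuous
    { toFun v := ⟨fun t ↦ ∫ s in (t₁ : ℝ)..t, v (projIcc a b hab s), by
        have h : Continuous fun s ↦ v (projIcc a b hab s) := v.continuous.comp continuous_projIcc
        exact (intervalIntegral.continuous_primitive
          (fun _ _ ↦ h.intervalIntegrable _ _) _).comp continuous_subtype_val⟩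
      map_add' v w := by
        ext t
        exact intervalIntegral.integral_add
          ((v.continuous.comp continuous_projIcc).intervalIntegrable _ _)
          ((w.continuous.comp continuous_projIcc).intervalIntegrable _ _)
      map_smul' r v := by
        ext t
        exact intervalIntegral.integral_smul _ _ } (b - a)
    (fun v ↦ by
      rw [ContinuousMap.norm_le _ (mul_nonneg (sub_nonneg.2 hab) (norm_nonneg _))]
      intro t
      refine (intervalIntegral.norm_integral_le_of_norm_le_const
        (fun s _ ↦ v.norm_coe_le_norm (projIcc a b hab s))).trans ?_
      rw [mul_comm]
      gcongr
      rw [abs_le]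
      constructor <;> linarith [t.2.1, t.2.2, t₁.2.1, t₁.2.2])

section

variable {E : Type*} [NormedAddCommGroup E] [NormedSpace ℝ E] [CompleteSpace E]
    {a b : ℝ} (hab : a ≤ b) (t₁ : Icc a b)

theorem integralOperator_apply (v : C(Icc a b, E)) (t : Icc a b) :
    integralOperator E hab t₁ v t = ∫ s in (t₁ : ℝ)..t, v (projIcc a b hab s) := rfl

theorem norm_integralOperator_le : ‖integralOperator E hab t₁‖ ≤ b - a :=
  LinearMap.mkContinuous_norm_le _ (sub_nonneg.2 hab) _

theorem integralOperator_self (v : C(Icc a b, E)) : integralOperator E hab t₁ v t₁ = 0 :=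
  intervalIntegral.integral_same

theorem hasDerivWithinAt_integralOperator (v : C(Icc a b, E)) {t : ℝ} (ht : t ∈ Icc a b) :
    HasDerivWithinAt (fun t ↦ integralOperator E hab t₁ v (projIcc a b hab t)) (v ⟨t, ht⟩)
      (Icc a b) t := by
  have h : Continuous fun s ↦ v (projIcc a b hab s) := v.continuous.comp continuous_projIcc
  have := (h.integral_hasStrictDerivAt (t₁ : ℝ) t).hasDerivAt.hasDerivWithinAt (s := Icc a b)
  rw [projIcc_of_mem hab ht] at this
  refine this.congr (fun s hs ↦ ?_) ?_ <;>
  simp [integralOperator_apply, projIcc_of_mem hab, *]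

/-- Turns solutions of the differential equation into solutions of the integral equation, so that
injectivity of the Picard operator yields uniqueness. The difference has zero derivative on an
interval, hence is constant. -/
theorem eq_add_integralOperator {x : ℝ → E} {v u : C(Icc a b, E)} (hu : ∀ t : Icc a b, u t = x t)
    (hx : ∀ t (ht : t ∈ Icc a b), HasDerivWithinAt x (v ⟨t, ht⟩) (Icc a b) t) :
    u - integralOperator E hab t₁ v = ContinuousMap.const _ (x t₁) := by
  ext t
  have h (s) (hs : s ∈ Icc a b) := (hx s hs).sub (hasDerivWithinAt_integralOperator hab t₁ v hs)
  simp only [sub_self] at h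
  have := (convex_Icc a b).norm_image_sub_le_of_norm_hasDerivWithin_le (C := 0) h
    (fun _ _ ↦ by simp) t₁.2 t.2
  rw [zero_mul, norm_le_zero_iff, sub_eq_zero] at this
  simpa [hu, integralOperator_self] using this

end

section

variable {Y : Type*} [NormedAddCommGroup Y] [NormedSpace ℝ Y]
  {E : Type*} [NormedAddCommGroup E] [NormedSpace ℝ E]
  {a b : ℝ} (hab : a ≤ b) (t₁ : Icc a b) (Ω : C(Y × E, Y →L[ℝ] E))
  (y η : C(Icc a b, Y))

/-- The operator sending `u` to the function `t ↦ Ω(y(t), u(t)) η(t)`. -/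
def velocityOperator (u : C(Icc a b, E)) : C(Icc a b, E) :=
  ContinuousMap.bilinearComp _ (.id ℝ (Y →L[ℝ] E)) (Ω.comp (y.prodMk u)) η

@[simp]
theorem velocityOperator_apply (u : C(Icc a b, E)) (t : Icc a b) :
    velocityOperator Ω y η u t = Ω (y t, u t) (η t) := rfl

theorem contDiff_velocityOperator (hΩ : ContDiff ℝ ∞ Ω) :
    ContDiff ℝ ∞ (velocityOperator Ω y η) := by
  have h1 : ContDiff ℝ ∞ (fun u : C(Icc a b, E) ↦ y.prodMk u) := by
    have : (fun u : C(Icc a b, E) ↦ y.prodMk u) = fun u ↦ y.prodMk 0 +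
        (ContinuousLinearMap.inr ℝ Y E).compLeftContinuous ℝ (Icc a b) u := by
      ext <;> simp
    rw [this]
    exact contDiff_const.add (ContinuousLinearMap.contDiff _)
  exact (ContinuousLinearMap.contDiff (ContinuousMap.bilinearComp (Icc a b)
    (.id ℝ (Y →L[ℝ] E)) |>.flip η)).comp ((Ω.contDiff_postcomp hΩ).comp h1)

/-- Evaluation at `t` is linear and continuous, so it commutes with differentiation. This converts
the linearised operator equation into the pointwise variational equation. -/
theorem fderiv_velocityOperator_apply (hΩ : ContDiff ℝ ∞ Ω) (u w : C(Icc a b, E)) (t : Icc a b) :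
    fderiv ℝ (velocityOperator Ω y η) u w t =
      fderiv ℝ (fun x ↦ Ω (y t, x) (η t)) (u t) (w t) := by
  have h1 := ((contDiff_velocityOperator Ω y η hΩ).differentiable (by simp) u).hasFDerivAt
  have h2 := (ContinuousMap.evalCLM ℝ t).hasFDerivAt.comp u h1
  have h3 : DifferentiableAt ℝ (fun x ↦ Ω (y t, x) (η t)) (u t) := by
    have := hΩ.differentiable (by simp)
    fun_prop
  have h4 := h3.hasFDerivAt.comp u (ContinuousMap.evalCLM ℝ t).hasFDerivAt
  exact DFunLike.congr_fun (h2.unique h4) w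

variable {κ R : ℝ}

theorem norm_velocityOperator_sub_le (hκ : ∀ z z', ‖Ω z - Ω z'‖ ≤ κ * ‖z - z'‖)
    (hκ0 : 0 ≤ κ) (hR : ∀ t, ‖η t‖ ≤ R) (hR0 : 0 ≤ R) (u v : C(Icc a b, E)) :
    ‖velocityOperator Ω y η u - velocityOperator Ω y η v‖ ≤ κ * R * ‖u - v‖ := by
  rw [ContinuousMap.norm_le _ (by positivity)]
  intro t
  have : ‖Ω (y t, u t) - Ω (y t, v t)‖ ≤ κ * ‖u - v‖ := by
    refine (hκ _ _).trans ?_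
    gcongr
    simpa using (u - v).norm_coe_le_norm t
  calc _ = ‖(Ω (y t, u t) - Ω (y t, v t)) (η t)‖ := by simp
    _ ≤ (κ * ‖u - v‖) * R := (ContinuousLinearMap.le_opNorm _ _).trans (by gcongr; exact hR t)
    _ = _ := by ring

variable [CompleteSpace E]

/-- The Picard operator `u ↦ u - ∫_{t₁} Ω(y, u) η`. -/
def picardDefect (u : C(Icc a b, E)) : C(Icc a b, E) :=
  u - integralOperator E hab t₁ (velocityOperator Ω y η u)

/-- The integral term is Lipschitz with constant `(b - a) κ R ≤ 1 / 2`, so the Picard operator is a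
small perturbation of the identity and hence a global homeomorphism. -/
theorem approximatesLinearOn_picardDefect (hκ : ∀ z z', ‖Ω z - Ω z'‖ ≤ κ * ‖z - z'‖)
    (hκ0 : 0 ≤ κ) (hR : ∀ t, ‖η t‖ ≤ R) (hR0 : 0 ≤ R) (hsmall : (b - a) * (κ * R) ≤ 1 / 2) :
    ApproximatesLinearOn (picardDefect hab t₁ Ω y η)
      (ContinuousLinearEquiv.refl ℝ C(Icc a b, E) : C(Icc a b, E) →L[ℝ] C(Icc a b, E))
      univ (1 / 2) := by
  intro u _ v _
  have h1 : picardDefect hab t₁ Ω y η u - picardDefect hab t₁ Ω y η v - (u - v) =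
      - integralOperator E hab t₁ (velocityOperator Ω y η u - velocityOperator Ω y η v) := by
    simp only [picardDefect, map_sub]
    abel
  change ‖picardDefect hab t₁ Ω y η u - picardDefect hab t₁ Ω y η v - (u - v)‖ ≤ _
  rw [h1, norm_neg]
  calc _ ≤ (b - a) * (κ * R * ‖u - v‖) := by
        refine (ContinuousLinearMap.le_opNorm _ _).trans ?_
        gcongr
        · exact norm_integralOperator_le hab t₁
        · exact norm_velocityOperator_sub_le Ω y η hκ hκ0 hR hR0 u v
    _ = (b - a) * (κ * R) * ‖u - v‖ := by ring
    _ ≤ _ := by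
      gcongr
      simpa using hsmall

/-- The solution operator of the integral equation. -/
theorem exists_homeomorph_picardDefect (hΩ : ContDiff ℝ ∞ Ω)
    (hκ : ∀ z z', ‖Ω z - Ω z'‖ ≤ κ * ‖z - z'‖)
    (hκ0 : 0 ≤ κ) (hR : ∀ t, ‖η t‖ ≤ R) (hR0 : 0 ≤ R) (hsmall : (b - a) * (κ * R) ≤ 1 / 2) :
    ∃ G : C(Icc a b, E) ≃ₜ C(Icc a b, E), ⇑G = picardDefect hab t₁ Ω y η ∧
      ContDiff ℝ ∞ G.symm := by
  have happ := approximatesLinearOn_picardDefect hab t₁ Ω y η hκ hκ0 hR hR0 hsmall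
  have hc : Subsingleton C(Icc a b, E) ∨ (1 / 2 : NNReal) <
      ‖((ContinuousLinearEquiv.refl ℝ C(Icc a b, E)).symm :
        C(Icc a b, E) →L[ℝ] C(Icc a b, E))‖₊⁻¹ := by
    rcases subsingleton_or_nontrivial C(Icc a b, E) with h | h
    · exact .inl h
    · right
      have : ‖((ContinuousLinearEquiv.refl ℝ C(Icc a b, E)).symm :
        C(Icc a b, E) →L[ℝ] C(Icc a b, E))‖₊ = 1 := by
          ext
          exact ContinuousLinearMap.norm_id
      rw [this]
      norm_num
  let G := happ.toHomeomorph _ hc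
  have hG : ⇑G = picardDefect hab t₁ Ω y η := rfl
  have hsm : ContDiff ℝ ∞ (picardDefect hab t₁ Ω y η) :=
    contDiff_id.sub ((integralOperator E hab t₁).contDiff.comp
      (contDiff_velocityOperator Ω y η hΩ))
  refine ⟨G, hG, ?_⟩
  have key (u : C(Icc a b, E)) : ∃ f' : C(Icc a b, E) ≃L[ℝ] C(Icc a b, E),
      HasFDerivAt G (f' : C(Icc a b, E) →L[ℝ] C(Icc a b, E)) u := by
    have h1 := (hsm.differentiable (by simp) u).hasFDerivAt
    -- The derivative of a map with Lipschitz constant `1 / 2` has norm at most `1 / 2`. A Neumann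
    -- series then inverts the derivative of the Picard operator.
    have h2 : ‖fderiv ℝ (picardDefect hab t₁ Ω y η) u - .id ℝ _‖ ≤ 1 / 2 := by
      have h3 := h1.sub (ContinuousLinearMap.id ℝ C(Icc a b, E)).hasFDerivAt
      refine h3.le_of_lip' (by norm_num) (Filter.Eventually.of_forall fun v ↦ ?_)
      have := happ v (mem_univ _) u (mem_univ _)
      refine le_trans (le_of_eq ?_) this
      congr 1
      change _ = picardDefect hab t₁ Ω y η v - picardDefect hab t₁ Ω y η u - (v - u)
      simp only [Pi.sub_apply, ContinuousLinearMap.id_apply]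
      abel
    obtain ⟨e, he⟩ := exists_continuousLinearEquiv_of_norm_sub_id_lt _
      (h2.trans_lt (by norm_num : (1 / 2 : ℝ) < 1))
    exact ⟨e, by rwa [hG, he]⟩
  choose f' hf' using key
  exact G.contDiff_symm hf' (hG ▸ hsm)

/-- Existence, uniqueness and smooth dependence on the initial value for the solutions of the
differential equation `x' = Ω(y(t), x) η(t)` on a short interval, and the variational equation. -/
theorem exists_smooth_flow (hΩ : ContDiff ℝ ∞ Ω)
    (hκ : ∀ z z', ‖Ω z - Ω z'‖ ≤ κ * ‖z - z'‖)
    (hκ0 : 0 ≤ κ) (hR : ∀ t, ‖η t‖ ≤ R) (hR0 : 0 ≤ R) (hsmall : (b - a) * (κ * R) ≤ 1 / 2) :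
    ∃ φ : E → ℝ → E, (∀ x, φ x t₁ = x) ∧
      (∀ x t (ht : t ∈ Icc a b), HasDerivWithinAt (φ x) (Ω (y ⟨t, ht⟩, φ x t) (η ⟨t, ht⟩))
        (Icc a b) t) ∧
      (∀ t ∈ Icc a b, ContDiff ℝ ∞ fun x ↦ φ x t) ∧
      (∀ x v t (ht : t ∈ Icc a b), HasDerivWithinAt (fun t ↦ fderiv ℝ (fun x ↦ φ x t) x v)
        (fderiv ℝ (fun z ↦ Ω (y ⟨t, ht⟩, z) (η ⟨t, ht⟩)) (φ x t) (fderiv ℝ (fun x ↦ φ x t) x v))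
        (Icc a b) t) ∧
      (∀ x : ℝ → E, (∀ t (ht : t ∈ Icc a b),
        HasDerivWithinAt x (Ω (y ⟨t, ht⟩, x t) (η ⟨t, ht⟩)) (Icc a b) t) →
        ∀ t ∈ Icc a b, x t = φ (x t₁) t) := by
  have hab : a ≤ b := t₁.2.1.trans t₁.2.2
  obtain ⟨G, hG, hGs⟩ := exists_homeomorph_picardDefect hab t₁ Ω y η hΩ hκ hκ0 hR hR0 hsmall
  let c : E →L[ℝ] C(Icc a b, E) := ContinuousLinearMap.const ℝ (Icc a b)
  have hc (x : E) (t) : c x t = x := rfl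
  -- The solution with value `x` at `t₁` is the preimage of the constant function `x`, so smooth
  -- dependence on `x` is smoothness of `G.symm`.
  let Φ : E → C(Icc a b, E) := fun x ↦ G.symm (c x)
  have hΦ : ContDiff ℝ ∞ Φ := hGs.comp c.contDiff
  have hΦeq (x : E) : Φ x = c x + integralOperator E hab t₁ (velocityOperator Ω y η (Φ x)) := by
    have h1 : G (Φ x) = c x := G.apply_symm_apply _
    rw [hG, picardDefect, sub_eq_iff_eq_add] at h1
    exact h1
  let W (x v : E) : C(Icc a b, E) := fderiv ℝ Φ x v
  -- Differentiate the fixed point identity `hΦeq` in the direction `v`: this is the variational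
  -- equation in integral form.
  have hW (x v : E) : W x v = c v + integralOperator E hab t₁
      (fderiv ℝ (velocityOperator Ω y η) (Φ x) (W x v)) := by
    have h1 := (hΦ.differentiable (by simp) x).hasFDerivAt
    have h2 := ((contDiff_velocityOperator Ω y η hΩ).differentiable (by simp) (Φ x)).hasFDerivAt
    have h3 := c.hasFDerivAt.add ((integralOperator E hab t₁).hasFDerivAt.comp x (h2.comp x h1))
      (x := x)
    have h4 : Φ = ⇑c + ⇑(integralOperator E hab t₁) ∘ velocityOperator Ω y η ∘ Φ :=
      funext hΦeq
    rw [← h4] at h3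
    exact DFunLike.congr_fun (h1.unique h3) v
  have hfd (x v : E) (t : ℝ) : fderiv ℝ (fun x ↦ Φ x (projIcc a b hab t)) x v =
      W x v (projIcc a b hab t) := by
    have h1 := (hΦ.differentiable (by simp) x).hasFDerivAt
    have h2 := (ContinuousMap.evalCLM ℝ (projIcc a b hab t)).hasFDerivAt.comp x h1
    have h3 : HasFDerivAt (fun x ↦ Φ x (projIcc a b hab t)) _ x := h2
    rw [h3.fderiv]
    rfl
  refine ⟨fun x t ↦ Φ x (projIcc a b hab t), fun x ↦ ?_, fun x t ht ↦ ?_, fun t ht ↦ ?_,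
    fun x v t ht ↦ ?_, fun x hx t ht ↦ ?_⟩
  · simp only [projIcc_val]
    rw [hΦeq, ContinuousMap.add_apply, integralOperator_self, hc, add_zero]
  · have h1 := (hasDerivWithinAt_integralOperator hab t₁ (velocityOperator Ω y η (Φ x)) ht).const_add
      x
    rw [velocityOperator_apply] at h1
    simp only [projIcc_of_mem hab ht]
    refine h1.congr_of_mem (fun s _ ↦ ?_) ht
    conv_lhs => rw [hΦeq]
    rfl
  · exact (ContinuousLinearMap.contDiff (ContinuousMap.evalCLM ℝ (projIcc a b hab t))).comp hΦ
  · simp only [hfd]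
    have h1 := (hasDerivWithinAt_integralOperator hab t₁
      (fderiv ℝ (velocityOperator Ω y η) (Φ x) (W x v)) ht).const_add v
    rw [fderiv_velocityOperator_apply Ω y η hΩ] at h1
    simp only [projIcc_of_mem hab ht]
    refine h1.congr_of_mem (fun s _ ↦ ?_) ht
    conv_lhs => rw [hW]
    rfl
  · let u : C(Icc a b, E) := ⟨fun t ↦ x t, continuousOn_iff_continuous_domRestrict.1
      fun t ht ↦ (hx t ht).continuousWithinAt⟩
    have h1 : G u = c (x t₁) := by
      rw [hG]
      exact eq_add_integralOperator hab t₁ (v := velocityOperator Ω y η u) (u := u)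
        (fun _ ↦ rfl) hx
    have h2 : u = Φ (x t₁) := (G.symm_apply_eq.2 h1.symm).symm
    simp only [← h2, projIcc_of_mem hab ht]
    rfl

end

end Flow

/-! ### The contact connection as a graph, and invariance of the kernel. -/

section HorizontalLinearAlgebra

variable {V : Type*} [NormedAddCommGroup V] [NormedSpace ℝ V]

/-- The exterior derivative at `z` of the `1`-form `β` on a vector space, as a bilinear map. -/
def bilinearD (β : V → V →L[ℝ] ℝ) (z : V) : V →L[ℝ] V →L[ℝ] ℝ :=
  fderiv ℝ β z - (fderiv ℝ β z).flip

theorem bilinearD_apply (β : V → V →L[ℝ] ℝ) (z a b : V) :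
    bilinearD β z a b = fderiv ℝ β z a b - fderiv ℝ β z b a := rfl

variable {Y E : Type*} [NormedAddCommGroup Y] [NormedSpace ℝ Y] [FiniteDimensional ℝ Y]
  [NormedAddCommGroup E] [NormedSpace ℝ E] [FiniteDimensional ℝ E]

/-- For a `1`-form `β` on an open set of `Y × E` that is contact in the direction of `E`, the
contact connection is the graph of a smooth family of linear maps `Y → E`. -/
theorem exists_horizontal_graph {β : Y × E → Y × E →L[ℝ] ℝ} {O : Set (Y × E)} (hO : IsOpen O)
    (hβ : ContDiffOn ℝ ∞ β O) (hne : ∀ z ∈ O, ∃ w, β z (0, w) ≠ 0)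
    (hnd : ∀ z ∈ O, ∀ w, β z (0, w) = 0 →
      (∀ w', β z (0, w') = 0 → bilinearD β z (0, w) (0, w') = 0) → w = 0) :
    ∃ (A : Y × E → Y →L[ℝ] E) (r : Y × E → Y →L[ℝ] ℝ), ContDiffOn ℝ ∞ A O ∧ ContinuousOn r O ∧
      (∀ z ∈ O, ∀ u, β z (u, A z u) = 0 ∧
        ∀ w', bilinearD β z (u, A z u) (0, w') = - (r z u * β z (0, w'))) ∧
      (∀ z ∈ O, ∀ u w, β z (u, w) = 0 →
        (∀ w', β z (0, w') = 0 → bilinearD β z (u, w) (0, w') = 0) → w = A z u) := by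
  let Q (z : Y × E) : Y × E →L[ℝ] E →L[ℝ] ℝ :=
    (bilinearD β z).bilinearComp (.id ℝ _) (.inr ℝ Y E)
  let b (z : Y × E) : E →L[ℝ] ℝ := (β z).comp (.inr ℝ Y E)
  have hD : ContDiffOn ℝ ∞ (fderiv ℝ β) O := hβ.fderiv_of_isOpen hO (by norm_cast)
  have hQ (a : Y × E) : ContDiffOn ℝ ∞ (fun z ↦ Q z a) O := by
    rw [contDiffOn_clm_apply]
    intro w
    have h1 : ContDiffOn ℝ ∞ (fun z ↦ fderiv ℝ β z a (0, w)) O :=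
      (hD.clm_apply contDiffOn_const).clm_apply contDiffOn_const
    have h2 : ContDiffOn ℝ ∞ (fun z ↦ fderiv ℝ β z (0, w) a) O :=
      (hD.clm_apply contDiffOn_const).clm_apply contDiffOn_const
    exact h1.sub h2
  have hb : ContDiffOn ℝ ∞ b O := by
    rw [contDiffOn_clm_apply]
    exact fun w ↦ hβ.clm_apply contDiffOn_const
  -- `dβ` alone need not be invertible on `E`. Horizontality requires `dβ(u + w, ·)` to vanish only
  -- on the kernel of `b`, that is, to be a multiple of `b`. The multiplier `c` becomes an extra
  -- unknown and `β = 0` an extra equation, which gives a square system that is invertible exactly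
  -- by the contact condition. Its solution has components `A` and `r`.
  let T (z : Y × E) : E × ℝ →L[ℝ] (E →L[ℝ] ℝ) × ℝ :=
    (((Q z).comp (.inr ℝ Y E)).coprod (.toSpanSingleton ℝ (b z))).prod ((b z).comp (.fst ℝ E ℝ))
  have hT_apply (z w c) : T z (w, c) = (Q z (0, w) + c • b z, b z w) := rfl
  have hT : ContDiffOn ℝ ∞ T O := by
    rw [contDiffOn_clm_apply]
    rintro ⟨w, c⟩
    exact ((hQ (0, w)).add (hb.const_smul c)).prodMk (hb.clm_apply contDiffOn_const)
  have hTinj (z) (hz : z ∈ O) : Function.Injective (T z) := by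
    rw [injective_iff_map_eq_zero]
    rintro ⟨w, c⟩ h
    rw [hT_apply, Prod.mk_eq_zero] at h
    -- Tested on the kernel of `b`, the multiplier term disappears and nondegeneracy applies.
    have hw : w = 0 := by
      refine hnd z hz w h.2 fun w' hw' ↦ ?_
      have := DFunLike.congr_fun h.1 w'
      have h0 : b z w' = 0 := hw'
      rw [add_apply, smul_apply, h0, smul_zero,
        add_zero] at this
      exact this
    subst hw
    obtain ⟨w', hw'⟩ := hne z hz
    have h1 : c • b z = 0 := by
      have := h.1
      rwa [Prod.mk_zero_zero, map_zero, zero_add] at this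
    have h2 : b z ≠ 0 := fun h0 ↦ hw' (DFunLike.congr_fun h0 w')
    rw [(smul_eq_zero.1 h1).resolve_right h2]
    rfl
  have hfin : Module.finrank ℝ (E × ℝ) = Module.finrank ℝ ((E →L[ℝ] ℝ) × ℝ) := by
    rw [Module.finrank_prod, Module.finrank_prod]
    congr 1
    rw [← (LinearMap.toContinuousLinearMap (𝕜 := ℝ) (E := E) (F' := ℝ)).finrank_eq]
    exact (Subspace.dual_finrank_eq).symm
  have hTinv (z) (hz : z ∈ O) : (T z).IsInvertible :=
    ⟨(LinearEquiv.ofInjectiveOfFinrankEq (T z).toLinearMap (hTinj z hz)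
      hfin).toContinuousLinearEquiv, rfl⟩
  let N (z : Y × E) : Y →L[ℝ] (E →L[ℝ] ℝ) × ℝ :=
    -(((Q z).comp (.inl ℝ Y E)).prod ((β z).comp (.inl ℝ Y E)))
  have hN : ContDiffOn ℝ ∞ N O := by
    rw [contDiffOn_clm_apply]
    intro u
    exact ((hQ (u, 0)).prodMk (hβ.clm_apply contDiffOn_const)).neg
  let S (z : Y × E) : Y →L[ℝ] E × ℝ := (T z).inverse.comp (N z)
  have hS : ContDiffOn ℝ ∞ S O := by
    intro z hz
    have h1 : ContDiffWithinAt ℝ ∞ (fun z ↦ (T z).inverse) O z :=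
      ((hTinv z hz).contDiffAt_map_inverse).comp_contDiffWithinAt z (hT z hz)
    exact h1.clm_comp (hN z hz)
  have hTS (z) (hz : z ∈ O) (u : Y) : T z (S z u) = N z u := by
    change ((T z).comp (T z).inverse) (N z u) = N z u
    rw [(hTinv z hz).self_comp_inverse]
    rfl
  let A (z : Y × E) : Y →L[ℝ] E := (ContinuousLinearMap.fst ℝ E ℝ).comp (S z)
  let r (z : Y × E) : Y →L[ℝ] ℝ := (ContinuousLinearMap.snd ℝ E ℝ).comp (S z)
  have hsplit (z : Y × E) (u : Y) (w : E) : ((u, w) : Y × E) = (u, 0) + (0, w) := by simp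
  have key (z) (hz : z ∈ O) (u : Y) : β z (u, A z u) = 0 ∧
        ∀ w', bilinearD β z (u, A z u) (0, w') = - (r z u * β z (0, w')) := by
    have h : (Q z (0, A z u) + r z u • b z, b z (A z u)) = (-Q z (u, 0), -β z (u, 0)) := hTS z hz u
    rw [Prod.mk.injEq] at h
    refine ⟨?_, fun w' ↦ ?_⟩
    · rw [hsplit z, map_add]
      have : β z (0, A z u) = -β z (u, 0) := h.2
      rw [this, add_neg_cancel]
    · have h1 : Q z (0, A z u) w' + r z u * β z (0, w') = - Q z (u, 0) w' :=
        DFunLike.congr_fun h.1 w'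
      have h2 : bilinearD β z (u, A z u) (0, w') = Q z (u, 0) w' + Q z (0, A z u) w' := by
        rw [hsplit z, map_add]
        rfl
      rw [h2]
      linarith
  refine ⟨A, r, contDiffOn_const.clm_comp hS, (contDiffOn_const.clm_comp hS).continuousOn, key,
    fun z hz u w h1 h2 ↦ ?_⟩
  -- Two horizontal vectors over `u` differ by a vertical one in the kernel of `β` that is
  -- `dβ`-orthogonal to the vertical kernel; nondegeneracy makes it zero.
  have hsub : ((0, w - A z u) : Y × E) = (u, w) - (u, A z u) := by simp
  rw [← sub_eq_zero]
  refine hnd z hz _ ?_ fun w' hw' ↦ ?_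
  · rw [hsub, map_sub, h1, (key z hz u).1, sub_zero]
  · rw [hsub, map_sub, sub_apply, h2 w' hw', (key z hz u).2 w', hw']
    simp

omit [FiniteDimensional ℝ Y] [FiniteDimensional ℝ E] in
/-- The variational equation of the horizontal lift equation preserves the kernel of the form. -/
theorem form_eq_zero_of_variational {β : Y × E → Y × E →L[ℝ] ℝ} {O : Set (Y × E)} (hO : IsOpen O)
    (hβ : ContDiffOn ℝ ∞ β O) {A : Y × E → Y →L[ℝ] E} {r : Y × E → Y →L[ℝ] ℝ}
    (hA : ContDiffOn ℝ ∞ A O) (hr : ContinuousOn r O)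
    (hAr : ∀ z ∈ O, ∀ u, β z (u, A z u) = 0 ∧
        ∀ w', bilinearD β z (u, A z u) (0, w') = - (r z u * β z (0, w')))
    {a b : ℝ} {y η : ℝ → Y} {x w : ℝ → E} (hη : ContinuousOn η (Icc a b))
    (hmem : ∀ t ∈ Icc a b, (y t, x t) ∈ O)
    (hy : ∀ t ∈ Icc a b, HasDerivWithinAt y (η t) (Icc a b) t)
    (hx : ∀ t ∈ Icc a b, HasDerivWithinAt x (A (y t, x t) (η t)) (Icc a b) t)
    (hw : ∀ t ∈ Icc a b, HasDerivWithinAt w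
      (fderiv ℝ (fun z ↦ A (y t, z) (η t)) (x t) (w t)) (Icc a b) t)
    {t₁ t₂ : ℝ} (h₁ : t₁ ∈ Icc a b) (h₂ : t₂ ∈ Icc a b) (h0 : β (y t₁, x t₁) (0, w t₁) = 0) :
    β (y t₂, x t₂) (0, w t₂) = 0 := by
  have hab : a ≤ b := h₁.1.trans h₁.2
  have hyx : ContinuousOn (fun t ↦ (y t, x t)) (Icc a b) := fun t ht ↦
    (hy t ht).continuousWithinAt.prodMk (hx t ht).continuousWithinAt
  have hf (t) (ht : t ∈ Icc a b) : HasDerivWithinAt (fun t ↦ β (y t, x t) (0, w t))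
      (- (r (y t, x t) (η t) * β (y t, x t) (0, w t))) (Icc a b) t := by
    set z : Y × E := (y t, x t) with hz
    have hzO : z ∈ O := hmem t ht
    have hβd : HasFDerivAt β (fderiv ℝ β z) z :=
      ((hβ.contDiffAt (hO.mem_nhds hzO)).differentiableAt (by simp)).hasFDerivAt
    have h1 : HasDerivWithinAt (fun t ↦ β (y t, x t)) (fderiv ℝ β z (η t, A z (η t)))
        (Icc a b) t := by
      exact hβd.comp_hasDerivWithinAt t ((hy t ht).prodMk (hx t ht))
    have h2 : HasDerivWithinAt (fun t ↦ ((0, w t) : Y × E))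
        (0, fderiv ℝ (fun z ↦ A (y t, z) (η t)) (x t) (w t)) (Icc a b) t :=
      (hasDerivWithinAt_const t (Icc a b) (0 : Y)).prodMk (hw t ht)
    have h3 := h1.clm_apply h2
    have hAd : HasFDerivAt (fun s ↦ A (y t, s) (η t))
        (fderiv ℝ (fun z ↦ A (y t, z) (η t)) (x t)) (x t) := by
      have h4 : DifferentiableAt ℝ A (y t, x t) :=
        (hA.contDiffAt (hO.mem_nhds hzO)).differentiableAt (by simp)
      have h5 : DifferentiableAt ℝ (fun s ↦ (y t, s)) (x t) := by fun_prop
      have h6 : DifferentiableAt ℝ (fun s ↦ A (y t, s)) (x t) := h4.comp (x t) h5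
      exact (h6.clm_apply (differentiableAt_const _)).hasFDerivAt
    -- Differentiate the identity `β(y, s)(η, A(y, s) η) = 0` in `s` along `w`. Subtracting it from
    -- the product rule `h3` antisymmetrises the derivative of `β`, and what remains is `dβ(h, w) =
    -- -r β(w)`.
    have hzero : fderiv ℝ β z (0, w t) (η t, A z (η t)) +
        β z (0, fderiv ℝ (fun z ↦ A (y t, z) (η t)) (x t) (w t)) = 0 := by
      have h5 : HasFDerivAt (fun s ↦ (y t, s)) (ContinuousLinearMap.inr ℝ Y E) (x t) :=
        (hasFDerivAt_const (y t) (x t)).prodMk (hasFDerivAt_id (x t))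
      have h6 := (HasFDerivAt.comp (x t) hβd h5).clm_apply
        ((hasFDerivAt_const (η t) (x t)).prodMk hAd)
      have h7 : (fun s ↦ (β ∘ fun s ↦ (y t, s)) s (η t, A (y t, s) (η t))) =ᶠ[𝓝 (x t)]
          fun _ ↦ (0 : ℝ) := by
        have : ∀ᶠ s in 𝓝 (x t), (y t, s) ∈ O :=
          (Continuous.prodMk_right (y t)).continuousAt.eventually (hO.mem_nhds hzO)
        filter_upwards [this] with s hs
        exact (hAr _ hs (η t)).1
      have h8 := (h6.congr_of_eventuallyEq h7.symm).unique (hasFDerivAt_const 0 (x t))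
      have h9 := DFunLike.congr_fun h8 (w t)
      simp only [Function.comp, add_apply, ContinuousLinearMap.comp_apply,
        ContinuousLinearMap.prod_apply, ContinuousLinearMap.flip_apply,
        ContinuousLinearMap.inr_apply, zero_apply] at h9
      rw [add_comm]
      exact h9
    have h10 := (hAr z hzO (η t)).2 (w t)
    rw [bilinearD_apply] at h10
    refine h3.congr_deriv ?_
    rw [hz] at hzero h10 ⊢
    linarith
  let v : C(Icc a b, ℝ) := ⟨fun t ↦ r (y t, x t) (η t), by
    have : ContinuousOn (fun t ↦ r (y t, x t) (η t)) (Icc a b) :=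
      (hr.comp hyx hmem).clm_apply hη
    exact continuousOn_iff_continuous_domRestrict.1 this⟩
  -- The exponential of `∫ r(η)` is an integrating factor, so this product is constant.
  have hg (t) (ht : t ∈ Icc a b) : HasDerivWithinAt (fun t ↦ β (y t, x t) (0, w t) *
      Real.exp (integralOperator ℝ hab ⟨t₁, h₁⟩ v (projIcc a b hab t))) 0 (Icc a b) t := by
    refine ((hf t ht).mul
      (hasDerivWithinAt_integralOperator hab ⟨t₁, h₁⟩ v ht).exp).congr_deriv ?_
    have hv : v ⟨t, ht⟩ = r (y t, x t) (η t) := rfl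
    rw [hv]
    ring
  have := (convex_Icc a b).norm_image_sub_le_of_norm_hasDerivWithin_le (C := 0) hg
    (fun _ _ ↦ by simp) h₁ h₂
  rw [zero_mul, norm_le_zero_iff, sub_eq_zero, h0, zero_mul] at this
  exact (mul_eq_zero.1 this).resolve_right (Real.exp_ne_zero _)

end HorizontalLinearAlgebra

/-! ### Pull-backs of forms and the exterior derivative in arbitrary parametrizations. -/

section Pullback

variable {E : Type*} [NormedAddCommGroup E] [NormedSpace ℝ E]
  {M : Type*} [TopologicalSpace M] [ChartedSpace E M]
  {V : Type*} [NormedAddCommGroup V] [NormedSpace ℝ V]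

/-- The pull-back of a `1`-form by a map from a vector space. -/
def OneForm.pull (α : OneForm E M) (Ψ : V → M) (z : V) : V →L[ℝ] ℝ :=
  (α (Ψ z)).comp (mfderiv 𝓘(ℝ, V) 𝓘(ℝ, E) Ψ z)

theorem OneForm.pull_apply (α : OneForm E M) (Ψ : V → M) (z v : V) :
    α.pull Ψ z v = α (Ψ z) (mfderiv 𝓘(ℝ, V) 𝓘(ℝ, E) Ψ z v) := rfl

variable [IsManifold 𝓘(ℝ, E) ∞ M]

theorem OneForm.IsSmooth.contDiffOn_pull [FiniteDimensional ℝ V] {α : OneForm E M}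
    (hα : α.IsSmooth)
    {Ψ : V → M} {O : Set V} (hO : IsOpen O) (hΨ : ContMDiffOn 𝓘(ℝ, V) 𝓘(ℝ, E) ∞ Ψ O) :
    ContDiffOn ℝ ∞ (α.pull Ψ) O := by
  have : IsManifold 𝓘(ℝ, E) 1 M := IsManifold.of_le (n := ∞) (by norm_cast)
  rw [contDiffOn_clm_apply]
  intro v
  rw [← contMDiffOn_iff_contDiffOn]
  intro z hz
  have hΨz : ContMDiffAt 𝓘(ℝ, V) 𝓘(ℝ, E) ∞ Ψ z := (hΨ z hz).contMDiffAt (hO.mem_nhds hz)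
  have h1 : ContMDiffAt 𝓘(ℝ, V) 𝓘(ℝ, V).tangent ∞
      (fun z : V ↦ (TotalSpace.mk' V z v : TangentBundle 𝓘(ℝ, V) V)) z :=
    contMDiff_vectorSpace_iff_contDiff.2 (contDiff_const (c := v)) z
  have h2 : ContMDiffAt 𝓘(ℝ, V) 𝓘(ℝ, E).tangent ∞ (fun z : V ↦
      (TotalSpace.mk' E (Ψ z) (mfderiv 𝓘(ℝ, V) 𝓘(ℝ, E) Ψ z v) : TangentBundle 𝓘(ℝ, E) M)) z := by
    have h3 := ContMDiffAt.mfderiv_const (m := ∞) hΨz (by norm_cast)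
    exact ContMDiffAt.clm_apply_of_inCoordinates h3 h1 hΨz
  have h4 : ContMDiffAt 𝓘(ℝ, V) (𝓘(ℝ, E).prod 𝓘(ℝ, E →L[ℝ] ℝ)) ∞
    (fun z : V ↦ TotalSpace.mk' (E →L[ℝ] ℝ)
      (E := fun p : M ↦ TangentSpace 𝓘(ℝ, E) p →L[ℝ] ℝ) (Ψ z) (α (Ψ z))) z :=
    (hα (Ψ z)).comp z hΨz
  have h5 := ContMDiffAt.clm_bundle_apply (F₂ := ℝ) (E₂ := Bundle.Trivial M ℝ) h4 h2
  exact (contMDiffAt_totalSpace.1 h5).2.contMDiffWithinAt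

/-- For a `1`-form, the alternating sum defining `extDeriv` has two terms, one for each argument
removed; they are the two terms of `bilinearD`. -/
theorem OneForm.d_eq_bilinearD_chart [FiniteDimensional ℝ E] {α : OneForm E M} (hα : α.IsSmooth)
    (p : M) (v w : TangentSpace 𝓘(ℝ, E) p) :
    α.d p ![v, w] = bilinearD (α.pull (extChartAt 𝓘(ℝ, E) p).symm) (extChartAt 𝓘(ℝ, E) p p)
      (mfderiv 𝓘(ℝ, E) 𝓘(ℝ, E) (extChartAt 𝓘(ℝ, E) p) p v)
      (mfderiv 𝓘(ℝ, E) 𝓘(ℝ, E) (extChartAt 𝓘(ℝ, E) p) p w) := by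
  set θ : E → E →L[ℝ] ℝ := α.pull (extChartAt 𝓘(ℝ, E) p).symm
  set x : E := extChartAt 𝓘(ℝ, E) p p
  set a : E := mfderiv 𝓘(ℝ, E) 𝓘(ℝ, E) (extChartAt 𝓘(ℝ, E) p) p v
  set b : E := mfderiv 𝓘(ℝ, E) 𝓘(ℝ, E) (extChartAt 𝓘(ℝ, E) p) p w
  have hθ : DifferentiableAt ℝ θ x :=
    ((hα.contDiffOn_pull (isOpen_extChartAt_target p)
      (contMDiffOn_extChartAt_symm p)).contDiffAt
      ((isOpen_extChartAt_target p).mem_nhds (mem_extChartAt_target p))).differentiableAt (by simp)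
  let L : (E →L[ℝ] ℝ) →ₗ[ℝ] E [⋀^Fin 1]→L[ℝ] ℝ :=
    { toFun := ContinuousAlternatingMap.ofSubsingleton ℝ E ℝ (0 : Fin 1)
      map_add' := fun _ _ ↦ rfl
      map_smul' := fun _ _ ↦ rfl }
  have hin : DifferentiableAt ℝ (α.inChart p) x :=
    (L.toContinuousLinearMap.differentiableAt (x := θ x)).comp x hθ
  have h1 : α.d p ![v, w] = extDeriv (α.inChart p) x ![a, b] := by
    refine congrArg (extDeriv (α.inChart p) x) ?_
    ext i
    fin_cases i <;> rfl
  rw [h1, extDeriv_apply hin, Fin.sum_univ_two, bilinearD_apply]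
  have h2 (c : E) (i : Fin 2) (hc : i.removeNth ![a, b] = fun _ ↦ c) (d : E) :
      fderiv ℝ (α.inChart p · (i.removeNth ![a, b])) x d = fderiv ℝ θ x d c := by
    have h3 : (α.inChart p · (i.removeNth ![a, b])) = fun y ↦ θ y c := by
      funext y
      rw [hc]
      rfl
    rw [h3]
    have h4 := hθ.hasFDerivAt.clm_apply (hasFDerivAt_const c x)
    rw [h4.fderiv]
    simp
  rw [h2 b 0 (by ext j; fin_cases j; rfl), h2 a 1 (by ext j; fin_cases j; rfl)]
  simp
  ring

/-- The terms containing the second derivative of `g` cancel by its symmetry. -/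
theorem bilinearD_pullback {W : Type*} [NormedAddCommGroup W] [NormedSpace ℝ W]
    {θ : W → W →L[ℝ] ℝ} {g : V → W} {z : V} (hθ : DifferentiableAt ℝ θ (g z))
    (hg : ContDiffAt ℝ ∞ g z) (u v : V) :
    bilinearD (fun z ↦ (θ (g z)).comp (fderiv ℝ g z)) z u v =
      bilinearD θ (g z) (fderiv ℝ g z u) (fderiv ℝ g z v) := by
  have h1 : HasFDerivAt g (fderiv ℝ g z) z := (hg.differentiableAt (by simp)).hasFDerivAt
  have h2 : HasFDerivAt (fderiv ℝ g) (fderiv ℝ (fderiv ℝ g) z) z :=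
    ((hg.fderiv_right (m := 1) (by norm_cast)).differentiableAt (by simp)).hasFDerivAt
  have h3 := (hθ.hasFDerivAt.comp z h1).clm_comp h2
  have hsymm : IsSymmSndFDerivAt ℝ g z := hg.isSymmSndFDerivAt (by simp; norm_cast)
  have h4 : fderiv ℝ (fun z ↦ (θ (g z)).comp (fderiv ℝ g z)) z = _ := h3.fderiv
  rw [bilinearD_apply, bilinearD_apply, h4]
  simp [hsymm.eq u v]

/-- The exterior derivative can be computed in any parametrization. -/
theorem OneForm.d_eq_bilinearD_pull [FiniteDimensional ℝ E] {α : OneForm E M} (hα : α.IsSmooth)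
    {Ψ : V → M} {O : Set V} (hO : IsOpen O) (hΨ : ContMDiffOn 𝓘(ℝ, V) 𝓘(ℝ, E) ∞ Ψ O)
    {z : V} (hz : z ∈ O) (u v : V) :
    α.d (Ψ z) ![mfderiv 𝓘(ℝ, V) 𝓘(ℝ, E) Ψ z u, mfderiv 𝓘(ℝ, V) 𝓘(ℝ, E) Ψ z v] =
      bilinearD (α.pull Ψ) z u v := by
  set φ := extChartAt 𝓘(ℝ, E) (Ψ z)
  set g : V → E := φ ∘ Ψ
  have hΨz : ContMDiffAt 𝓘(ℝ, V) 𝓘(ℝ, E) ∞ Ψ z := (hΨ z hz).contMDiffAt (hO.mem_nhds hz)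
  have hφ : ContMDiffAt 𝓘(ℝ, E) 𝓘(ℝ, E) ∞ φ (Ψ z) := contMDiffAt_extChartAt
  have hg : ContDiffAt ℝ ∞ g z := contMDiffAt_iff_contDiffAt.1 (hφ.comp z hΨz)
  have hθ : ContDiffOn ℝ ∞ (α.pull φ.symm) φ.target :=
    hα.contDiffOn_pull (isOpen_extChartAt_target _) (contMDiffOn_extChartAt_symm _)
  have hθd : DifferentiableAt ℝ (α.pull φ.symm) (g z) :=
    (hθ.contDiffAt ((isOpen_extChartAt_target _).mem_nhds (mem_extChartAt_target _))).differentiableAt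
      (by simp)
  -- Near `z` the map `Ψ` factors as `φ.symm ∘ g`, so its pull-back is the pull-back by `g` of the
  -- form in the chart. An identity on a neighbourhood is needed because it is differentiated below.
  have heq : α.pull Ψ =ᶠ[𝓝 z] fun z ↦ (α.pull φ.symm (g z)).comp (fderiv ℝ g z) := by
    have hsrc : ∀ᶠ z' in 𝓝 z, Ψ z' ∈ φ.source :=
      hΨz.continuousAt.eventually (extChartAt_source_mem_nhds _)
    filter_upwards [eventually_eventually_nhds.2 hsrc, hO.mem_nhds hz] with z' hz' hz'O
    have h1 : MDifferentiableAt 𝓘(ℝ, V) 𝓘(ℝ, E) Ψ z' :=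
      ((hΨ z' hz'O).contMDiffAt (hO.mem_nhds hz'O)).mdifferentiableAt (by simp)
    have hs : Ψ z' ∈ φ.source := hz'.self_of_nhds
    have h2 : MDifferentiableAt 𝓘(ℝ, E) 𝓘(ℝ, E) φ (Ψ z') :=
      mdifferentiableAt_extChartAt (by rwa [extChartAt_source] at hs)
    have h3 : MDifferentiableAt 𝓘(ℝ, E) 𝓘(ℝ, E) φ.symm (g z') :=
      ((contMDiffOn_extChartAt_symm (n := ∞) (Ψ z)).contMDiffAt
        ((isOpen_extChartAt_target _).mem_nhds (φ.map_source hs))).mdifferentiableAt (by simp)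
    have h4 : MDifferentiableAt 𝓘(ℝ, V) 𝓘(ℝ, E) g z' := h2.comp z' h1
    have h5 : Ψ =ᶠ[𝓝 z'] φ.symm ∘ g := by
      filter_upwards [hz'] with y hy
      exact (φ.left_inv hy).symm
    have h6 : mfderiv 𝓘(ℝ, V) 𝓘(ℝ, E) (φ.symm ∘ g) z' =
        (mfderiv 𝓘(ℝ, E) 𝓘(ℝ, E) φ.symm (g z')).comp (mfderiv 𝓘(ℝ, V) 𝓘(ℝ, E) g z') :=
      mfderiv_comp z' h3 h4
    have h7 : α.pull Ψ z' = α.pull (φ.symm ∘ g) z' := by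
      ext v
      rw [OneForm.pull_apply, OneForm.pull_apply, h5.mfderiv_eq, h5.self_of_nhds]
    rw [h7]
    ext v
    rw [OneForm.pull_apply, h6, mfderiv_eq_fderiv]
    rfl
  have hd : mfderiv 𝓘(ℝ, V) 𝓘(ℝ, E) g z =
      (mfderiv 𝓘(ℝ, E) 𝓘(ℝ, E) φ (Ψ z)).comp (mfderiv 𝓘(ℝ, V) 𝓘(ℝ, E) Ψ z) :=
    mfderiv_comp z (hφ.mdifferentiableAt (by simp)) (hΨz.mdifferentiableAt (by simp))
  rw [mfderiv_eq_fderiv] at hd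
  have h8 : bilinearD (α.pull Ψ) z =
      bilinearD (fun z ↦ (α.pull φ.symm (g z)).comp (fderiv ℝ g z)) z := by
    rw [bilinearD, bilinearD, heq.fderiv_eq]
  rw [h8, bilinearD_pullback hθd hg, OneForm.d_eq_bilinearD_chart hα, hd]
  rfl

end Pullback

/-! ### Charts adapted to the fibration, and the connection in them. -/

section FibredCharts

variable {EC : Type*} [NormedAddCommGroup EC] [NormedSpace ℝ EC]
  {C : Type*} [TopologicalSpace C] [ChartedSpace EC C]
  {EB : Type*} [NormedAddCommGroup EB] [NormedSpace ℝ EB]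
  {B : Type*} [TopologicalSpace B] [ChartedSpace EB B]
  {EF : Type*} [NormedAddCommGroup EF] [NormedSpace ℝ EF]
  {F : Type*} [TopologicalSpace F] [ChartedSpace EF F]

/-- A smooth chart `ψ` of the total space of `pr : C → B`, with values in `EB × EF`, that lies over
a smooth chart `χ` of the base. -/
structure IsFibredChart (EC : Type*) [NormedAddCommGroup EC] [NormedSpace ℝ EC]
    {C : Type*} [TopologicalSpace C] [ChartedSpace EC C] (pr : C → B)
    (ψ : OpenPartialHomeomorph C (EB × EF)) (χ : OpenPartialHomeomorph B EB) : Prop where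
  contMDiffOn : ContMDiffOn 𝓘(ℝ, EC) 𝓘(ℝ, EB × EF) ∞ ψ ψ.source
  contMDiffOn_symm : ContMDiffOn 𝓘(ℝ, EB × EF) 𝓘(ℝ, EC) ∞ ψ.symm ψ.target
  contMDiffOn_base : ContMDiffOn 𝓘(ℝ, EB) 𝓘(ℝ, EB) ∞ χ χ.source
  contMDiffOn_base_symm : ContMDiffOn 𝓘(ℝ, EB) 𝓘(ℝ, EB) ∞ χ.symm χ.target
  mapsTo : ∀ p ∈ ψ.source, pr p ∈ χ.source
  fst_apply : ∀ p ∈ ψ.source, (ψ p).1 = χ (pr p)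

/-- Compose a local trivialization with a product of charts of the base and of the typical fibre. -/
theorem IsSmoothFibration.exists_isFibredChart [IsManifold 𝓘(ℝ, EB) ∞ B] [IsManifold 𝓘(ℝ, EF) ∞ F]
    {pr : C → B} (h : IsSmoothFibration (EC := EC) (EB := EB) EF F pr) (p₀ : C) :
    ∃ (ψ : OpenPartialHomeomorph C (EB × EF)) (χ : OpenPartialHomeomorph B EB),
      IsFibredChart EC pr ψ χ ∧ p₀ ∈ ψ.source := by
  obtain ⟨e, hb, he⟩ := h.locallyTrivial (pr p₀)
  let χ := chartAt EB (pr p₀)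
  let c := chartAt EF (e p₀).2
  let ψ : OpenPartialHomeomorph C (EB × EF) := e.toOpenPartialHomeomorph.trans (χ.prod c)
  have hsrc (p : C) : p ∈ ψ.source ↔ pr p ∈ e.baseSet ∧ (e p).1 ∈ χ.source ∧ (e p).2 ∈ c.source := by
    simp only [ψ, OpenPartialHomeomorph.trans_source, OpenPartialHomeomorph.prod_source]
    rw [mem_inter_iff, e.mem_source]
    rfl
  have hψ (p : C) : ψ p = (χ (e p).1, c (e p).2) := rfl
  have htgt (z : EB × EF) : z ∈ ψ.target ↔
      (z.1 ∈ χ.target ∧ z.2 ∈ c.target) ∧ (χ.symm z.1, c.symm z.2) ∈ e.target := by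
    simp only [ψ, OpenPartialHomeomorph.trans_target, OpenPartialHomeomorph.prod_target]
    rfl
  have hψs (z : EB × EF) : ψ.symm z = e.toOpenPartialHomeomorph.symm (χ.symm z.1, c.symm z.2) := rfl
  refine ⟨ψ, χ, ⟨?_, ?_, contMDiffOn_chart, contMDiffOn_chart_symm, fun p hp ↦ ?_,
    fun p hp ↦ ?_⟩, ?_⟩
  · have h0 : ψ.source ⊆ e.source := fun p hp ↦ e.mem_source.2 ((hsrc p).1 hp).1
    have h1 := he.contMDiffOn_toFun.mono h0
    have h2 : ContMDiffOn 𝓘(ℝ, EC) 𝓘(ℝ, EB) ∞ (fun p ↦ χ (e p).1) ψ.source :=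
      (contMDiffOn_chart (I := 𝓘(ℝ, EB)) (x := pr p₀)).comp (contMDiff_fst.comp_contMDiffOn h1)
        fun p hp ↦ ((hsrc p).1 hp).2.1
    have h3 : ContMDiffOn 𝓘(ℝ, EC) 𝓘(ℝ, EF) ∞ (fun p ↦ c (e p).2) ψ.source :=
      (contMDiffOn_chart (I := 𝓘(ℝ, EF)) (x := (e p₀).2)).comp (contMDiff_snd.comp_contMDiffOn h1)
        fun p hp ↦ ((hsrc p).1 hp).2.2
    exact h2.prodMk_space h3
  · have h1 : ContMDiffOn 𝓘(ℝ, EB × EF) 𝓘(ℝ, EB) ∞ (fun z : EB × EF ↦ χ.symm z.1) ψ.target :=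
      (contMDiffOn_chart_symm (I := 𝓘(ℝ, EB)) (x := pr p₀)).comp
        contDiff_fst.contMDiff.contMDiffOn fun z hz ↦ ((htgt z).1 hz).1.1
    have h2 : ContMDiffOn 𝓘(ℝ, EB × EF) 𝓘(ℝ, EF) ∞ (fun z : EB × EF ↦ c.symm z.2) ψ.target :=
      (contMDiffOn_chart_symm (I := 𝓘(ℝ, EF)) (x := (e p₀).2)).comp
        contDiff_snd.contMDiff.contMDiffOn fun z hz ↦ ((htgt z).1 hz).1.2
    exact he.contMDiffOn_invFun.comp (h1.prodMk h2) fun z hz ↦ ((htgt z).1 hz).2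
  · have := ((hsrc p).1 hp).2.1
    rwa [e.coe_fst' ((hsrc p).1 hp).1] at this
  · rw [hψ, e.coe_fst' ((hsrc p).1 hp).1]
  · rw [hsrc, e.coe_fst' hb]
    exact ⟨hb, mem_chart_source _ _, mem_chart_source _ _⟩

namespace IsFibredChart

variable {pr : C → B} {ψ : OpenPartialHomeomorph C (EB × EF)} {χ : OpenPartialHomeomorph B EB}

theorem mdifferentiable (hψ : IsFibredChart EC pr ψ χ) :
    ψ.MDifferentiable 𝓘(ℝ, EC) 𝓘(ℝ, EB × EF) :=
  ⟨hψ.contMDiffOn.mdifferentiableOn (by simp), hψ.contMDiffOn_symm.mdifferentiableOn (by simp)⟩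

theorem mdifferentiable_base (hψ : IsFibredChart EC pr ψ χ) :
    χ.MDifferentiable 𝓘(ℝ, EB) 𝓘(ℝ, EB) :=
  ⟨hψ.contMDiffOn_base.mdifferentiableOn (by simp),
    hψ.contMDiffOn_base_symm.mdifferentiableOn (by simp)⟩

theorem pr_symm_apply (hψ : IsFibredChart EC pr ψ χ) {z : EB × EF} (hz : z ∈ ψ.target) {b : B}
    (hb : b ∈ χ.source) (h : z.1 = χ b) : pr (ψ.symm z) = b := by
  have h1 := ψ.map_target hz
  refine χ.injOn (hψ.mapsTo _ h1) hb ?_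
  rw [← hψ.fst_apply _ h1, ψ.right_inv hz, h]

theorem mfderiv_base_comp (hψ : IsFibredChart EC pr ψ χ)
    (hpr : MDifferentiable 𝓘(ℝ, EC) 𝓘(ℝ, EB) pr) {p : C} (hp : p ∈ ψ.source)
    (v : TangentSpace 𝓘(ℝ, EC) p) :
    mfderiv 𝓘(ℝ, EB) 𝓘(ℝ, EB) χ (pr p) (mfderiv 𝓘(ℝ, EC) 𝓘(ℝ, EB) pr p v) =
      (mfderiv 𝓘(ℝ, EC) 𝓘(ℝ, EB × EF) ψ p v : EB × EF).1 := by
  have h1 : HasMFDerivAt 𝓘(ℝ, EC) 𝓘(ℝ, EB) (χ ∘ pr) p _ :=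
    (hψ.mdifferentiable_base.mdifferentiableAt (hψ.mapsTo p hp)).hasMFDerivAt.comp p
      (hpr p).hasMFDerivAt
  have h2 : HasMFDerivAt 𝓘(ℝ, EC) 𝓘(ℝ, EB) (Prod.fst ∘ ψ) p _ :=
    (ContinuousLinearMap.fst ℝ EB EF).hasMFDerivAt.comp p
      (hψ.mdifferentiable.mdifferentiableAt hp).hasMFDerivAt
  have h3 : χ ∘ pr =ᶠ[𝓝 p] Prod.fst ∘ ψ := by
    filter_upwards [ψ.open_source.mem_nhds hp] with q hq
    exact (hψ.fst_apply q hq).symm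
  exact DFunLike.congr_fun (hasMFDerivAt_unique h1 (h2.congr_of_eventuallyEq h3)) v

theorem mfderiv_apply_mfderiv_symm (hψ : IsFibredChart EC pr ψ χ) {z : EB × EF}
    (hz : z ∈ ψ.target) (a : EB × EF) :
    mfderiv 𝓘(ℝ, EC) 𝓘(ℝ, EB × EF) ψ (ψ.symm z) (mfderiv 𝓘(ℝ, EB × EF) 𝓘(ℝ, EC) ψ.symm z a) = a :=
  DFunLike.congr_fun (hψ.mdifferentiable.comp_symm_deriv hz) a

theorem mfderiv_symm_apply_mfderiv (hψ : IsFibredChart EC pr ψ χ) {z : EB × EF}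
    (hz : z ∈ ψ.target) (v : TangentSpace 𝓘(ℝ, EC) (ψ.symm z)) :
    mfderiv 𝓘(ℝ, EB × EF) 𝓘(ℝ, EC) ψ.symm z
      (mfderiv 𝓘(ℝ, EC) 𝓘(ℝ, EB × EF) ψ (ψ.symm z) v) = v := by
  have := hψ.mdifferentiable.symm_comp_deriv (ψ.map_target hz)
  rw [ψ.right_inv hz] at this
  exact DFunLike.congr_fun this v

/-- The derivative of `χ` is injective, so a vector is vertical exactly when its image under the
derivative of `ψ` has zero base component. -/
theorem mem_verticalSpace_iff (hψ : IsFibredChart EC pr ψ χ)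
    (hpr : MDifferentiable 𝓘(ℝ, EC) 𝓘(ℝ, EB) pr) {z : EB × EF} (hz : z ∈ ψ.target)
    (v : TangentSpace 𝓘(ℝ, EC) (ψ.symm z)) :
    v ∈ verticalSpace (EC := EC) (EB := EB) pr (ψ.symm z) ↔
      ∃ w : EF, v = mfderiv 𝓘(ℝ, EB × EF) 𝓘(ℝ, EC) ψ.symm z ((0, w) : EB × EF) := by
  have hp := ψ.map_target hz
  have h1 := hψ.mfderiv_base_comp hpr hp v
  have hinj := hψ.mdifferentiable_base.mfderiv_injective (hψ.mapsTo _ hp)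
  have h2 : v ∈ verticalSpace (EC := EC) (EB := EB) pr (ψ.symm z) ↔
      mfderiv 𝓘(ℝ, EC) 𝓘(ℝ, EB) pr (ψ.symm z) v = 0 := LinearMap.mem_ker
  rw [h2, ← map_eq_zero_iff _ hinj, h1]
  constructor
  · intro h3
    refine ⟨(mfderiv 𝓘(ℝ, EC) 𝓘(ℝ, EB × EF) ψ (ψ.symm z) v : EB × EF).2, ?_⟩
    rw [← hψ.mfderiv_symm_apply_mfderiv hz v]
    congr 1
    refine Prod.ext h3 ?_
    rw [hψ.mfderiv_symm_apply_mfderiv hz v]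
  · rintro ⟨w, rfl⟩
    rw [hψ.mfderiv_apply_mfderiv_symm hz]
    rfl

variable [FiniteDimensional ℝ EC] [FiniteDimensional ℝ EB] [FiniteDimensional ℝ EF]
  [IsManifold 𝓘(ℝ, EC) ∞ C]

/-- In a fibred chart, the contact connection is the graph of a smooth family of linear maps. -/
theorem exists_contactConnection_graph (hψ : IsFibredChart EC pr ψ χ) {α : OneForm EC C}
    (h : IsContactFibration (EB := EB) EF F pr α) :
    ∃ (A : EB × EF → EB →L[ℝ] EF) (r : EB × EF → EB →L[ℝ] ℝ),
      ContDiffOn ℝ ∞ A ψ.target ∧ ContinuousOn r ψ.target ∧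
      (∀ z ∈ ψ.target, ∀ u, α.pull ψ.symm z (u, A z u) = 0 ∧
        ∀ w', bilinearD (α.pull ψ.symm) z (u, A z u) (0, w') =
          - (r z u * α.pull ψ.symm z (0, w'))) ∧
      ∀ z ∈ ψ.target, ∀ (u : EB) (w : EF),
        mfderiv 𝓘(ℝ, EB × EF) 𝓘(ℝ, EC) ψ.symm z ((u, w) : EB × EF) ∈
          contactConnection EB pr α (ψ.symm z) ↔ w = A z u := by
  have hpr := h.fibration.contMDiff.mdifferentiable (by simp)
  have hβ := h.contactForm.smooth.contDiffOn_pull ψ.open_target hψ.contMDiffOn_symm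
  have hd {z : EB × EF} (hz : z ∈ ψ.target) (a b : EB × EF) :=
    OneForm.d_eq_bilinearD_pull h.contactForm.smooth ψ.open_target hψ.contMDiffOn_symm hz a b
  -- Both arguments are the contact condition on the fibres, with vertical vectors written as images
  -- of `(0, w)`.
  obtain ⟨A, r, hA, hr, hAr, huniq⟩ := exists_horizontal_graph ψ.open_target hβ
    (fun z hz ↦ by
      obtain ⟨v, hv, hv'⟩ := (h.contact_fibre (ψ.symm z)).1
      obtain ⟨w, rfl⟩ := (hψ.mem_verticalSpace_iff hpr hz v).1 hv
      exact ⟨w, hv'⟩)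
    (fun z hz w hw hw' ↦ by
      have h1 := (h.contact_fibre (ψ.symm z)).2 _ ((hψ.mem_verticalSpace_iff hpr hz _).2 ⟨w, rfl⟩) hw
        (fun v hv hv0 ↦ by
          obtain ⟨w', rfl⟩ := (hψ.mem_verticalSpace_iff hpr hz v).1 hv
          rw [hd hz]
          exact hw' w' hv0)
      have h2 := hψ.mfderiv_apply_mfderiv_symm hz ((0, w) : EB × EF)
      rw [h1, map_zero] at h2
      exact (congrArg Prod.snd h2).symm)
  refine ⟨A, r, hA, hr, hAr, fun z hz u w ↦ ⟨fun hH ↦ ?_, ?_⟩⟩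
  · refine huniq z hz u w hH.1 fun w' hw' ↦ ?_
    rw [← hd hz]
    exact hH.2 _ ((hψ.mem_verticalSpace_iff hpr hz _).2 ⟨w', rfl⟩) hw'
  · rintro rfl
    refine ⟨(hAr z hz u).1, fun v hv hv0 ↦ ?_⟩
    obtain ⟨w', rfl⟩ := (hψ.mem_verticalSpace_iff hpr hz v).1 hv
    rw [hd hz, (hAr z hz u).2 w']
    have h0 : α.pull ψ.symm z (0, w') = 0 := hv0
    rw [h0, mul_zero, neg_zero]

end IsFibredChart

end FibredCharts

/-! ### Fibres as manifolds, on a type synonym that carries the instances. -/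

section Fibre

variable {EC : Type*} [NormedAddCommGroup EC] [NormedSpace ℝ EC]
  {C : Type*} [TopologicalSpace C] [ChartedSpace EC C]
  {EB : Type*} [NormedAddCommGroup EB] [NormedSpace ℝ EB]
  {B : Type*} [TopologicalSpace B] [ChartedSpace EB B]
  {EF : Type*} [NormedAddCommGroup EF] [NormedSpace ℝ EF]
  {F : Type*} [TopologicalSpace F] [ChartedSpace EF F] {pr : C → B}

/-- The fibre over `b`, with its manifold structure. -/
def IsSmoothFibration.Fibre (_h : IsSmoothFibration (EC := EC) (EB := EB) EF F pr) (b : B) :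
    Type _ :=
  pr ⁻¹' {b}

namespace IsSmoothFibration

variable (h : IsSmoothFibration (EC := EC) (EB := EB) EF F pr) {b : B}

instance : TopologicalSpace (h.Fibre b) := inferInstanceAs (TopologicalSpace (pr ⁻¹' {b}))

instance : ChartedSpace EF (h.Fibre b) := h.fibreChartedSpace b

instance [IsManifold 𝓘(ℝ, EF) ∞ F] : IsManifold 𝓘(ℝ, EF) ∞ (h.Fibre b) := h.isManifold_fibre b

/-- The inclusion of the fibre. -/
def incl (b : B) (p : h.Fibre b) : C := Subtype.val p

theorem pr_incl (p : h.Fibre b) : pr (h.incl b p) = b := p.2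

theorem incl_injective : Function.Injective (h.incl b) := Subtype.val_injective

/-- The identification of the fibre with the typical fibre. -/
def fibreHomeomorph (e : Trivialization F pr) (hb : b ∈ e.baseSet) : h.Fibre b ≃ₜ F :=
  e.preimageSingletonHomeomorph hb

theorem fibreHomeomorph_apply (e : Trivialization F pr) (hb : b ∈ e.baseSet) (p : h.Fibre b) :
    h.fibreHomeomorph e hb p = (e (h.incl b p)).2 := rfl

theorem incl_fibreHomeomorph_symm (e : Trivialization F pr) (hb : b ∈ e.baseSet) (x : F) :
    h.incl b ((h.fibreHomeomorph e hb).symm x) = e.toOpenPartialHomeomorph.symm (b, x) := rfl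

/-- The restriction of a `1`-form to the fibre. -/
def restrict (α : OneForm EC C) (b : B) : OneForm EF (h.Fibre b) := h.fibreForm α b

theorem restrict_apply (α : OneForm EC C) (p : h.Fibre b) (v : TangentSpace 𝓘(ℝ, EF) p) :
    h.restrict α b p v = α (h.incl b p) (mfderiv 𝓘(ℝ, EF) 𝓘(ℝ, EC) (h.incl b) p v) := rfl

variable [IsManifold 𝓘(ℝ, EF) ∞ F] {e : Trivialization F pr} (hb : b ∈ e.baseSet)
  (he : IsSmoothTrivialization (EC := EC) (EB := EB) EF e)

include he in
theorem mem_maximalAtlas (x : F) :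
    (h.fibreHomeomorph e hb).toOpenPartialHomeomorph.trans (chartAt EF x) ∈
      IsManifold.maximalAtlas 𝓘(ℝ, EF) ∞ (h.Fibre b) :=
  IsManifold.subset_maximalAtlas ⟨e, hb, he, _, chart_mem_atlas _ _, rfl⟩

include he in
theorem contMDiff_fibreHomeomorph :
    ContMDiff 𝓘(ℝ, EF) 𝓘(ℝ, EF) ∞ (h.fibreHomeomorph e hb) := by
  intro p
  set x := h.fibreHomeomorph e hb p
  have h1 := contMDiffOn_of_mem_maximalAtlas (h.mem_maximalAtlas hb he x)
  have h2 : ContMDiffAt 𝓘(ℝ, EF) 𝓘(ℝ, EF) ∞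
      ((h.fibreHomeomorph e hb).toOpenPartialHomeomorph.trans (chartAt EF x)) p :=
    h1.contMDiffAt (OpenPartialHomeomorph.open_source _ |>.mem_nhds (by simp [x]))
  have h3 : ContMDiffAt 𝓘(ℝ, EF) 𝓘(ℝ, EF) ∞ (chartAt EF x).symm (chartAt EF x x) :=
    contMDiffOn_chart_symm.contMDiffAt
      ((chartAt EF x).open_target.mem_nhds (mem_chart_target _ _))
  refine (h3.comp p h2).congr_of_eventuallyEq ?_
  have h4 : ∀ᶠ q in 𝓝 p, h.fibreHomeomorph e hb q ∈ (chartAt EF x).source :=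
    (h.fibreHomeomorph e hb).continuous.continuousAt.eventually (chart_source_mem_nhds _ _)
  filter_upwards [h4] with q hq
  exact ((chartAt EF x).left_inv hq).symm

include he in
theorem contMDiff_fibreHomeomorph_symm :
    ContMDiff 𝓘(ℝ, EF) 𝓘(ℝ, EF) ∞ (h.fibreHomeomorph e hb).symm := by
  intro x
  have h1 := contMDiffOn_symm_of_mem_maximalAtlas (h.mem_maximalAtlas hb he x)
  have h2 : ContMDiffAt 𝓘(ℝ, EF) 𝓘(ℝ, EF) ∞
      ((h.fibreHomeomorph e hb).toOpenPartialHomeomorph.trans (chartAt EF x)).symm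
        (chartAt EF x x) :=
    h1.contMDiffAt (OpenPartialHomeomorph.open_target _ |>.mem_nhds (by simp))
  have h3 : ContMDiffAt 𝓘(ℝ, EF) 𝓘(ℝ, EF) ∞ (chartAt EF x) x :=
    contMDiffOn_chart.contMDiffAt (chart_source_mem_nhds _ _)
  refine (h2.comp x h3).congr_of_eventuallyEq ?_
  filter_upwards [chart_source_mem_nhds EF x] with y hy
  exact congrArg (h.fibreHomeomorph e hb).symm ((chartAt EF x).left_inv hy).symm

theorem contMDiff_incl : ContMDiff 𝓘(ℝ, EF) 𝓘(ℝ, EC) ∞ (h.incl b) := by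
  obtain ⟨e, hb, he⟩ := h.locallyTrivial b
  have h1 : ContMDiff 𝓘(ℝ, EF) (𝓘(ℝ, EB).prod 𝓘(ℝ, EF)) ∞
      (fun p : h.Fibre b ↦ (b, h.fibreHomeomorph e hb p)) :=
    contMDiff_const.prodMk (h.contMDiff_fibreHomeomorph hb he)
  refine (he.contMDiffOn_invFun.comp_contMDiff h1 fun p ↦ e.mem_target.2 hb).congr
    fun p ↦ ?_
  change _ = e.toOpenPartialHomeomorph.symm (b, h.fibreHomeomorph e hb p)
  rw [← h.incl_fibreHomeomorph_symm e hb, Homeomorph.symm_apply_apply]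

/-- The second component of a trivialization, followed by the identification of `F` with the fibre,
is a smooth left inverse of the inclusion. -/
theorem contMDiffAt_of_incl {E' N : Type*} [NormedAddCommGroup E'] [NormedSpace ℝ E']
    [TopologicalSpace N] [ChartedSpace E' N] {g : N → h.Fibre b} {x : N}
    (hg : ContMDiffAt 𝓘(ℝ, E') 𝓘(ℝ, EC) ∞ (h.incl b ∘ g) x) :
    ContMDiffAt 𝓘(ℝ, E') 𝓘(ℝ, EF) ∞ g x := by
  obtain ⟨e, hb, he⟩ := h.locallyTrivial b
  have h1 : ContMDiffAt 𝓘(ℝ, EC) (𝓘(ℝ, EB).prod 𝓘(ℝ, EF)) ∞ e (h.incl b (g x)) := by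
    refine he.contMDiffOn_toFun.contMDiffAt (e.open_source.mem_nhds ?_)
    rw [e.mem_source, h.pr_incl]
    exact hb
  have h2 := (h.contMDiff_fibreHomeomorph_symm hb he).contMDiffAt.comp x (h1.comp x hg).snd
  refine h2.congr_of_eventuallyEq (.of_forall fun y ↦ ?_)
  exact ((h.fibreHomeomorph e hb).symm_apply_apply (g y)).symm

end IsSmoothFibration

end Fibre

/-! ### Horizontal lifts, their equation in charts and their regularity. -/

section Lifts

variable {EC : Type*} [NormedAddCommGroup EC] [NormedSpace ℝ EC]
  {C : Type*} [TopologicalSpace C] [ChartedSpace EC C]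
  {EB : Type*} [NormedAddCommGroup EB] [NormedSpace ℝ EB]
  {B : Type*} [TopologicalSpace B] [ChartedSpace EB B]
  {EF : Type*} [NormedAddCommGroup EF] [NormedSpace ℝ EF]
  {F : Type*} [TopologicalSpace F] [ChartedSpace EF F]

/-- The velocity of a path defined on the unit interval. -/
def velocity (EB : Type*) [NormedAddCommGroup EB] [NormedSpace ℝ EB]
    {B : Type*} [TopologicalSpace B] [ChartedSpace EB B] (γ : ℝ → B) (t : ℝ) : EB :=
  mfderivWithin 𝓘(ℝ, ℝ) 𝓘(ℝ, EB) γ (Icc (0 : ℝ) 1) t (1 : ℝ)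

/-- `c` has the horizontal lift of the velocity of `γ` as derivative, within the set `J` of times. -/
def IsLiftOn (EB : Type*) [NormedAddCommGroup EB] [NormedSpace ℝ EB]
    {B : Type*} [TopologicalSpace B] [ChartedSpace EB B] (pr : C → B) (α : OneForm EC C) (γ : ℝ → B)
    (c : ℝ → C) (J : Set ℝ) : Prop :=
  ∀ t ∈ J, pr (c t) = γ t ∧ ∃ v ∈ contactConnection EB pr α (c t),
    (mfderiv 𝓘(ℝ, EC) 𝓘(ℝ, EB) pr (c t) v : EB) = velocity EB γ t ∧
    HasMFDerivWithinAt 𝓘(ℝ, ℝ) 𝓘(ℝ, EC) c J t (ContinuousLinearMap.toSpanSingleton ℝ v)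

namespace IsLiftOn

variable {pr : C → B} {α : OneForm EC C} {γ : ℝ → B} {c c' : ℝ → C} {J J' : Set ℝ}

theorem mono (h : IsLiftOn EB pr α γ c J) (hJ : J' ⊆ J) : IsLiftOn EB pr α γ c J' := by
  intro t ht
  obtain ⟨h1, v, hv, h2, h3⟩ := h t (hJ ht)
  exact ⟨h1, v, hv, h2, h3.mono hJ⟩

theorem congr (h : IsLiftOn EB pr α γ c J) (hc : EqOn c' c J) : IsLiftOn EB pr α γ c' J := by
  intro t ht
  rw [hc ht]
  obtain ⟨h1, v, hv, h2, h3⟩ := h t ht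
  exact ⟨h1, v, hv, h2, h3.congr_of_eventuallyEq (hc.eventuallyEq_of_mem self_mem_nhdsWithin)
    (hc ht)⟩

theorem continuousOn (h : IsLiftOn EB pr α γ c J) : ContinuousOn c J := fun t ht ↦ by
  obtain ⟨h1, v, hv, h2, h3⟩ := h t ht
  exact h3.continuousWithinAt

end IsLiftOn

section

variable [IsManifold 𝓘(ℝ, EC) ∞ C] {pr : C → B} {α : OneForm EC C}

/-- A horizontal vector is determined by its projection. -/
theorem IsContactFibration.eq_of_mem_contactConnection
    (h : IsContactFibration (EB := EB) EF F pr α) {p : C} {v w : TangentSpace 𝓘(ℝ, EC) p}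
    (hv : v ∈ contactConnection EB pr α p) (hw : w ∈ contactConnection EB pr α p)
    (hvw : mfderiv 𝓘(ℝ, EC) 𝓘(ℝ, EB) pr p v = mfderiv 𝓘(ℝ, EC) 𝓘(ℝ, EB) pr p w) : v = w := by
  have h1 := (contactConnection EB pr α p).sub_mem hv hw
  have h2 : mfderiv 𝓘(ℝ, EC) 𝓘(ℝ, EB) pr p (v - w) = 0 := by rw [map_sub, hvw, sub_self]
  exact sub_eq_zero.1 ((h.contact_fibre p).2 (v - w) h2 h1.1 h1.2)

/-- Derivatives within `[0,1]` are unique, so the vector in `IsLiftOn` is the velocity of `c`. Its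
projection is forced by differentiating `pr ∘ c = γ`. -/
theorem IsContactFibration.isLiftOn_iff (h : IsContactFibration (EB := EB) EF F pr α) {γ : ℝ → B}
    {c : ℝ → C} :
    IsLiftOn EB pr α γ c (Icc 0 1) ↔ (∀ t ∈ Icc (0 : ℝ) 1, pr (c t) = γ t) ∧
      MDifferentiableOn 𝓘(ℝ, ℝ) 𝓘(ℝ, EC) c (Icc (0 : ℝ) 1) ∧
      ∀ t ∈ Icc (0 : ℝ) 1, mfderivWithin 𝓘(ℝ, ℝ) 𝓘(ℝ, EC) c (Icc (0 : ℝ) 1) t (1 : ℝ) ∈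
        contactConnection EB pr α (c t) := by
  have huniq (t) (ht : t ∈ Icc (0 : ℝ) 1) : UniqueMDiffWithinAt 𝓘(ℝ, ℝ) (Icc (0 : ℝ) 1) t :=
    (uniqueDiffOn_Icc_zero_one t ht).uniqueMDiffWithinAt
  constructor
  · intro hc
    refine ⟨fun t ht ↦ (hc t ht).1, fun t ht ↦ ?_, fun t ht ↦ ?_⟩
    · obtain ⟨-, v, -, -, h1⟩ := hc t ht
      exact h1.mdifferentiableWithinAt
    · obtain ⟨-, v, hv, -, h1⟩ := hc t ht
      rw [h1.mfderivWithin (huniq t ht)]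
      refine Set.mem_of_eq_of_mem ?_ hv
      exact one_smul ℝ v
  · rintro ⟨h1, h2, h3⟩ t ht
    have h4 := (h2 t ht).hasMFDerivWithinAt
    refine ⟨h1 t ht, _, h3 t ht, ?_, h4.congr_mfderiv ?_⟩
    · have h5 := ((h.fibration.contMDiff.mdifferentiable (by simp)
        (c t)).hasMFDerivAt.comp_hasMFDerivWithinAt t h4).congr_of_eventuallyEq (f₁ := γ)
        (eventually_nhdsWithin_of_forall fun s hs ↦ (h1 s hs).symm) (h1 t ht).symm
      exact (DFunLike.congr_fun (h5.mfderivWithin (huniq t ht)) (1 : ℝ)).symm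
    · refine ContinuousLinearMap.ext fun r : ℝ ↦ ?_
      have h6 := map_smul (mfderivWithin 𝓘(ℝ, ℝ) 𝓘(ℝ, EC) c (Icc (0 : ℝ) 1) t) r (1 : ℝ)
      refine Eq.trans ?_ h6
      exact congrArg (fun x : ℝ ↦ mfderivWithin 𝓘(ℝ, ℝ) 𝓘(ℝ, EC) c (Icc (0 : ℝ) 1) t x)
        (mul_one r).symm

theorem IsContactFibration.isHorizontalLift_iff (h : IsContactFibration (EB := EB) EF F pr α)
    {γ : ℝ → B} {p₀ : C} {c : ℝ → C} :
    IsHorizontalLift EB pr α γ p₀ c ↔ c 0 = p₀ ∧ IsLiftOn EB pr α γ c (Icc 0 1) := by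
  rw [h.isLiftOn_iff]
  exact ⟨fun ⟨h1, h2, h3, h4⟩ ↦ ⟨h1, h2, h3, h4⟩, fun ⟨h1, h2, h3, h4⟩ ↦ ⟨h1, h2, h3, h4⟩⟩

/-- At a common time both pieces have horizontal velocities with the same projection, hence the same
velocity, so the one-sided derivatives fit together. No condition on how the two sets meet is needed
beyond closedness, even if one of them is a single point. -/
theorem IsLiftOn.exists_glue (h : IsContactFibration (EB := EB) EF F pr α) {γ : ℝ → B}
    {c₁ c₂ : ℝ → C} {J₁ J₂ : Set ℝ} (h₁ : IsLiftOn EB pr α γ c₁ J₁) (h₂ : IsLiftOn EB pr α γ c₂ J₂)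
    (hJ₁ : IsClosed J₁) (hJ₂ : IsClosed J₂) (heq : EqOn c₁ c₂ (J₁ ∩ J₂)) :
    ∃ c, EqOn c c₁ J₁ ∧ EqOn c c₂ J₂ ∧ IsLiftOn EB pr α γ c (J₁ ∪ J₂) := by
  classical
  let c := J₁.piecewise c₁ c₂
  have e₁ : EqOn c c₁ J₁ := piecewise_eqOn _ _ _
  have e₂ : EqOn c c₂ J₂ := fun t ht ↦ by
    by_cases ht' : t ∈ J₁
    · rw [e₁ ht', heq ⟨ht', ht⟩]
    · exact piecewise_eq_of_notMem _ _ _ ht'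
  refine ⟨c, e₁, e₂, fun t ht ↦ ?_⟩
  have k₁ := h₁.congr e₁
  have k₂ := h₂.congr e₂
  have hnot {J J' : Set ℝ} (hJ' : IsClosed J') (ht' : t ∉ J') : J ∈ 𝓝[J ∪ J'] t := by
    filter_upwards [self_mem_nhdsWithin, nhdsWithin_le_nhds (hJ'.isOpen_compl.mem_nhds ht')]
      with s hs hs'
    exact hs.resolve_right hs'
  by_cases t₁ : t ∈ J₁
  · obtain ⟨a₁, v₁, hv₁, b₁, d₁⟩ := k₁ t t₁
    refine ⟨a₁, v₁, hv₁, b₁, ?_⟩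
    by_cases t₂ : t ∈ J₂
    · obtain ⟨a₂, v₂, hv₂, b₂, d₂⟩ := k₂ t t₂
      have : v₁ = v₂ := h.eq_of_mem_contactConnection hv₁ hv₂ (b₁.trans b₂.symm)
      subst this
      exact d₁.union d₂
    · exact d₁.mono_of_mem_nhdsWithin (hnot hJ₂ t₂)
  · obtain ⟨a₂, v₂, hv₂, b₂, d₂⟩ := k₂ t (ht.resolve_left t₁)
    refine ⟨a₂, v₂, hv₂, b₂, d₂.mono_of_mem_nhdsWithin ?_⟩
    rw [union_comm]
    exact hnot hJ₁ t₁

end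

theorem HasMFDerivWithinAt.hasDerivWithinAt_one {E : Type*} [NormedAddCommGroup E] [NormedSpace ℝ E]
    {f : ℝ → E} {J : Set ℝ} {t : ℝ} {L : TangentSpace 𝓘(ℝ, ℝ) t →L[ℝ] TangentSpace 𝓘(ℝ, E) (f t)}
    (h : HasMFDerivWithinAt 𝓘(ℝ, ℝ) 𝓘(ℝ, E) f J t L) : HasDerivWithinAt f (L (1 : ℝ) : E) J t := by
  have h' : HasFDerivWithinAt f (show ℝ →L[ℝ] E from L) J t :=
    hasMFDerivWithinAt_iff_hasFDerivWithinAt.1 h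
  exact h'.hasDerivWithinAt

/-- The part of the unit interval where a path lies in a chart domain. -/
theorem exists_inter_isOpen_of_continuousOn {X : Type*} [TopologicalSpace X] {c : ℝ → X}
    {I : Set ℝ} (hc : ContinuousOn c I) {s : Set X} (hs : IsOpen s) :
    ∃ u, IsOpen u ∧ I ∩ c ⁻¹' s = I ∩ u := by
  obtain ⟨u, hu, h⟩ := continuousOn_iff'.1 hc s hs
  exact ⟨u, hu, by rw [inter_comm, h, inter_comm]⟩

theorem uniqueDiffOn_Icc_inter_preimage {X : Type*} [TopologicalSpace X] {c : ℝ → X}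
    (hc : ContinuousOn c (Icc (0 : ℝ) 1)) {s : Set X} (hs : IsOpen s) :
    UniqueDiffOn ℝ (Icc (0 : ℝ) 1 ∩ c ⁻¹' s) := by
  obtain ⟨u, hu, h⟩ := exists_inter_isOpen_of_continuousOn hc hs
  rw [h]
  exact (uniqueDiffOn_Icc_zero_one).inter hu

namespace IsFibredChart

variable {pr : C → B} {ψ : OpenPartialHomeomorph C (EB × EF)} {χ : OpenPartialHomeomorph B EB}
  (hψ : IsFibredChart EC pr ψ χ) {γ : ℝ → B}

/-- The velocity of a path in the base, in a chart. -/
def chartVelocity (χ : OpenPartialHomeomorph B EB) (γ : ℝ → B) (t : ℝ) : EB :=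
  mfderiv 𝓘(ℝ, EB) 𝓘(ℝ, EB) χ (γ t) (velocity EB γ t)

include hψ

theorem hasDerivWithinAt_base (hγ : ContMDiffOn 𝓘(ℝ, ℝ) 𝓘(ℝ, EB) 1 γ (Icc (0 : ℝ) 1)) {t : ℝ}
    (ht : t ∈ Icc (0 : ℝ) 1) (hχ : γ t ∈ χ.source) :
    HasDerivWithinAt (χ ∘ γ) (chartVelocity χ γ t) (Icc (0 : ℝ) 1) t := by
  have h1 := ((hγ t ht).mdifferentiableWithinAt (by simp)).hasMFDerivWithinAt
  have h2 := (hψ.mdifferentiable_base.mdifferentiableAt hχ).hasMFDerivAt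
  have h3 := h2.comp_hasMFDerivWithinAt t h1
  exact h3.hasDerivWithinAt_one

theorem contDiffOn_base {k : ℕ∞} (hγ : ContMDiffOn 𝓘(ℝ, ℝ) 𝓘(ℝ, EB) k γ (Icc (0 : ℝ) 1)) :
    ContDiffOn ℝ k (χ ∘ γ) (Icc (0 : ℝ) 1 ∩ γ ⁻¹' χ.source) := by
  rw [← contMDiffOn_iff_contDiffOn]
  exact (hψ.contMDiffOn_base.of_le (by exact_mod_cast le_top)).comp (hγ.mono inter_subset_left)
    fun t ht ↦ ht.2

theorem continuousOn_chartVelocity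
    (hγ : ContMDiffOn 𝓘(ℝ, ℝ) 𝓘(ℝ, EB) 1 γ (Icc (0 : ℝ) 1)) :
    ContinuousOn (chartVelocity χ γ) (Icc (0 : ℝ) 1 ∩ γ ⁻¹' χ.source) := by
  have hu := uniqueDiffOn_Icc_inter_preimage hγ.continuousOn χ.open_source
  have h1 := (hψ.contDiffOn_base (k := 1) hγ).continuousOn_derivWithin hu le_rfl
  refine h1.congr fun t ht ↦ ?_
  exact (((hψ.hasDerivWithinAt_base hγ ht.1 ht.2).mono inter_subset_left).derivWithin
    (hu t ht)).symm

variable {α : OneForm EC C} {A : EB × EF → EB →L[ℝ] EF}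
  (hpr : MDifferentiable 𝓘(ℝ, EC) 𝓘(ℝ, EB) pr)
  (hA : ∀ z ∈ ψ.target, ∀ (u : EB) (w : EF),
        mfderiv 𝓘(ℝ, EB × EF) 𝓘(ℝ, EC) ψ.symm z ((u, w) : EB × EF) ∈
          contactConnection EB pr α (ψ.symm z) ↔ w = A z u)

include hpr hA

/-- In a fibred chart, a horizontal lift satisfies a differential equation. -/
theorem hasDerivWithinAt_of_isLiftOn {c : ℝ → C} {J : Set ℝ} (hc : IsLiftOn EB pr α γ c J) {t : ℝ}
    (ht : t ∈ J) (hct : c t ∈ ψ.source) :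
    HasDerivWithinAt (fun s ↦ (ψ (c s)).2) (A (ψ (c t)) (chartVelocity χ γ t)) J t := by
  obtain ⟨h1, v, hv, h2, h3⟩ := hc t ht
  have h4 := (hψ.mdifferentiable.mdifferentiableAt hct).hasMFDerivAt.comp_hasMFDerivWithinAt t h3
  have h5 := h4.hasDerivWithinAt_one
  have h6 : HasDerivWithinAt (fun s ↦ (ψ (c s)).2) _ J t :=
    (ContinuousLinearMap.snd ℝ EB EF).hasFDerivAt.comp_hasDerivWithinAt t h5
  refine h6.congr_deriv ?_
  have hz := ψ.map_source hct
  have h7 : (mfderiv 𝓘(ℝ, EC) 𝓘(ℝ, EB × EF) ψ (c t) v : EB × EF).1 = chartVelocity χ γ t := by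
    rw [← hψ.mfderiv_base_comp hpr hct v, h2, h1]
    rfl
  have h8 : (mfderiv 𝓘(ℝ, EC) 𝓘(ℝ, EB × EF) ψ (c t) v : EB × EF).2 = A (ψ (c t))
      (mfderiv 𝓘(ℝ, EC) 𝓘(ℝ, EB × EF) ψ (c t) v : EB × EF).1 := by
    rw [← hA _ hz]
    have h9 := DFunLike.congr_fun (hψ.mdifferentiable.symm_comp_deriv hct) v
    rw [ψ.left_inv hct]
    refine Set.mem_of_eq_of_mem h9 hv
  rw [← h7, ← h8]
  change (mfderiv 𝓘(ℝ, EC) 𝓘(ℝ, EB × EF) ψ (c t) ((1 : ℝ) • v) : EB × EF).2 = _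
  rw [one_smul]

/-- In a fibred chart, the solutions of the differential equation are horizontal lifts. -/
theorem isLiftOn_of_hasDerivWithinAt
    (hγ : ContMDiffOn 𝓘(ℝ, ℝ) 𝓘(ℝ, EB) 1 γ (Icc (0 : ℝ) 1)) {x : ℝ → EF} {J : Set ℝ}
    (hJ : J ⊆ Icc 0 1) (hχ : ∀ t ∈ J, γ t ∈ χ.source) (hmem : ∀ t ∈ J, (χ (γ t), x t) ∈ ψ.target)
    (hx : ∀ t ∈ J, HasDerivWithinAt x (A (χ (γ t), x t) (chartVelocity χ γ t)) J t) :
    IsLiftOn EB pr α γ (fun t ↦ ψ.symm (χ (γ t), x t)) J := by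
  intro t ht
  have hz := hmem t ht
  have h0 : pr (ψ.symm (χ (γ t), x t)) = γ t := hψ.pr_symm_apply hz (hχ t ht) rfl
  set z : EB × EF := (χ (γ t), x t)
  set u := chartVelocity χ γ t with hu
  refine ⟨h0, mfderiv 𝓘(ℝ, EB × EF) 𝓘(ℝ, EC) ψ.symm z ((u, A z u) : EB × EF),
    (hA z hz _ _).2 rfl, ?_, ?_⟩
  · have h1 := hψ.mfderiv_base_comp hpr (ψ.map_target hz)
      (mfderiv 𝓘(ℝ, EB × EF) 𝓘(ℝ, EC) ψ.symm z ((u, A z u) : EB × EF))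
    rw [hψ.mfderiv_apply_mfderiv_symm hz, h0] at h1
    exact hψ.mdifferentiable_base.mfderiv_injective (hχ t ht) h1
  · have h1 := ((hψ.hasDerivWithinAt_base hγ (hJ ht) (hχ t ht)).mono hJ).prodMk (hx t ht)
    have h2 : HasMFDerivWithinAt 𝓘(ℝ, ℝ) 𝓘(ℝ, EB × EF) (fun t ↦ (χ (γ t), x t)) J t
        (ContinuousLinearMap.toSpanSingleton ℝ ((u, A z u) : EB × EF)) :=
      hasMFDerivWithinAt_iff_hasFDerivWithinAt.2 h1.hasFDerivWithinAt
    have h3 := (hψ.mdifferentiable.mdifferentiableAt_symm hz).hasMFDerivAt.comp_hasMFDerivWithinAt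
      t h2
    refine h3.congr_mfderiv ?_
    refine ContinuousLinearMap.ext fun s ↦ ?_
    exact (mfderiv 𝓘(ℝ, EB × EF) 𝓘(ℝ, EC) ψ.symm z).map_smul s ((u, A z u) : EB × EF)

/-- A horizontal lift of a path of class `C^k` is of class `C^k`. -/
theorem contMDiffWithinAt_of_isLiftOn (hAs : ContDiffOn ℝ ∞ A ψ.target) {k : ℕ∞} (hk : 1 ≤ k)
    (hγ : ContMDiffOn 𝓘(ℝ, ℝ) 𝓘(ℝ, EB) k γ (Icc (0 : ℝ) 1)) {c : ℝ → C}
    (hc : IsLiftOn EB pr α γ c (Icc 0 1)) {t₀ : ℝ} (ht₀ : t₀ ∈ Icc (0 : ℝ) 1)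
    (hct : c t₀ ∈ ψ.source) :
    ContMDiffWithinAt 𝓘(ℝ, ℝ) 𝓘(ℝ, EC) k c (Icc (0 : ℝ) 1) t₀ := by
  have hγ1 : ContMDiffOn 𝓘(ℝ, ℝ) 𝓘(ℝ, EB) 1 γ (Icc (0 : ℝ) 1) := hγ.of_le (by exact_mod_cast hk)
  set S : Set ℝ := Icc 0 1 ∩ c ⁻¹' ψ.source with hS
  have hu : UniqueDiffOn ℝ S := uniqueDiffOn_Icc_inter_preimage hc.continuousOn ψ.open_source
  have hSγ : S ⊆ Icc (0 : ℝ) 1 ∩ γ ⁻¹' χ.source := fun t ht ↦ by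
    refine ⟨ht.1, ?_⟩
    rw [mem_preimage, ← (hc t ht.1).1]
    exact hψ.mapsTo _ ht.2
  let y : ℝ → EB := χ ∘ γ
  let x : ℝ → EF := fun t ↦ (ψ (c t)).2
  have hψc (t) (ht : t ∈ S) : ψ (c t) = (y t, x t) := by
    refine Prod.ext ?_ rfl
    rw [hψ.fst_apply _ ht.2, (hc t ht.1).1]
    rfl
  have hy : ContDiffOn ℝ k y S := (hψ.contDiffOn_base hγ).mono hSγ
  have hyd (t) (ht : t ∈ S) : derivWithin y S t = chartVelocity χ γ t :=
    ((hψ.hasDerivWithinAt_base hγ1 ht.1 (hSγ ht).2).mono inter_subset_left).derivWithin (hu t ht)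
  have hx (t) (ht : t ∈ S) :
      HasDerivWithinAt x (A (y t, x t) (chartVelocity χ γ t)) S t := by
    have := (hψ.hasDerivWithinAt_of_isLiftOn hpr hA hc ht.1 ht.2).mono
      (inter_subset_left (t := c ⁻¹' ψ.source))
    rwa [hψc t ht] at this
  have hmem : MapsTo (fun t ↦ (y t, x t)) S ψ.target := fun t ht ↦ by
    change (y t, x t) ∈ _
    rw [← hψc t ht]
    exact ψ.map_source ht.2
  -- Bootstrapping: if `x` is `C^n` and `y` is `C^(n+1)`, then `x' = A(y, x) y'` is `C^n`.
  have key (n : ℕ) (hn : (n : ℕ∞) ≤ k) : ContDiffOn ℝ n x S := by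
    induction n with
    | zero => exact contDiffOn_zero.2 fun t ht ↦ (hx t ht).continuousWithinAt
    | succ n ih =>
      have hn' : (n : ℕ∞) ≤ k := le_trans (by exact_mod_cast n.le_succ) hn
      push_cast
      rw [contDiffOn_succ_iff_derivWithin hu]
      refine ⟨fun t ht ↦ (hx t ht).differentiableWithinAt, by simp, ?_⟩
      have h1 : ContDiffOn ℝ n (derivWithin y S) S := hy.derivWithin hu (by exact_mod_cast hn)
      have h2 : ContDiffOn ℝ n (fun t ↦ A (y t, x t)) S :=
        (hAs.of_le (by exact_mod_cast le_top)).comp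
          ((hy.of_le (by exact_mod_cast hn')).prodMk (ih hn')) hmem
      refine (h2.clm_apply h1).congr fun t ht ↦ ?_
      rw [(hx t ht).derivWithin (hu t ht), hyd t ht]
  have hxk : ContDiffOn ℝ k x S := contDiffOn_iff_forall_nat_le.2 key
  have h1 : ContMDiffOn 𝓘(ℝ, ℝ) 𝓘(ℝ, EC) k (fun t ↦ ψ.symm (y t, x t)) S :=
    (hψ.contMDiffOn_symm.of_le (by exact_mod_cast le_top)).comp
      (contMDiffOn_iff_contDiffOn.2 (hy.prodMk hxk)) hmem
  have h2 : ContMDiffOn 𝓘(ℝ, ℝ) 𝓘(ℝ, EC) k c S := h1.congr fun t ht ↦ by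
    rw [← hψc t ht, ψ.left_inv ht.2]
  refine (h2 t₀ ⟨ht₀, hct⟩).mono_of_mem_nhdsWithin ?_
  exact Filter.inter_mem self_mem_nhdsWithin
    ((hc.continuousOn t₀ ht₀).preimage_mem_nhdsWithin (ψ.open_source.mem_nhds hct))

end IsFibredChart

/-- A smooth map on an open set agrees near each point with a smooth map that is bounded and
Lipschitz. -/
theorem exists_bounded_lipschitz_extension {V W : Type*} [NormedAddCommGroup V] [NormedSpace ℝ V]
    [FiniteDimensional ℝ V] [NormedAddCommGroup W] [NormedSpace ℝ W] {A : V → W} {O : Set V}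
    (hO : IsOpen O) (hA : ContDiffOn ℝ ∞ A O) {z₀ : V} (hz₀ : z₀ ∈ O) :
    ∃ (Ω : C(V, W)) (κ M δ : ℝ), ContDiff ℝ ∞ Ω ∧ 0 ≤ κ ∧ 0 ≤ M ∧ 0 < δ ∧
      (∀ z z', ‖Ω z - Ω z'‖ ≤ κ * ‖z - z'‖) ∧ (∀ z, ‖Ω z‖ ≤ M) ∧
      Metric.ball z₀ δ ⊆ O ∧ EqOn Ω A (Metric.ball z₀ δ) := by
  obtain ⟨ε, hε, hεO⟩ := Metric.nhds_basis_closedBall.mem_iff.1 (hO.mem_nhds hz₀)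
  -- The bump equals `1` on the ball of radius `ε / 2` and is supported inside `O`. Compact support
  -- of the product yields both the Lipschitz constant and the bound.
  let ρ : ContDiffBump z₀ := ⟨ε / 2, ε, by positivity, by linarith⟩
  let Ω : V → W := fun z ↦ ρ z • A z
  have hs : ContDiff ℝ ∞ Ω := by
    rw [contDiff_iff_contDiffAt]
    intro z
    by_cases hz : z ∈ O
    · exact ρ.contDiffAt.smul (hA.contDiffAt (hO.mem_nhds hz))
    · have hz' : z ∉ tsupport ρ := fun h' ↦ hz (hεO (by rwa [ρ.tsupport_eq] at h'))
      have : Ω =ᶠ[𝓝 z] fun _ ↦ 0 := by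
        filter_upwards [(isClosed_tsupport ρ).isOpen_compl.mem_nhds hz'] with y hy
        simp [Ω, image_eq_zero_of_notMem_tsupport hy]
      exact contDiffAt_const.congr_of_eventuallyEq this
  have hcs : HasCompactSupport Ω := ρ.hasCompactSupport.smul_right
  obtain ⟨κ, hκ⟩ := hs.lipschitzWith_of_hasCompactSupport hcs (by simp)
  obtain ⟨M, hM⟩ := hcs.exists_bound_of_continuous hs.continuous
  refine ⟨⟨Ω, hs.continuous⟩, κ, M, ε / 2, hs, κ.2, (norm_nonneg _).trans (hM z₀), by positivity,
    fun z z' ↦ ?_, hM, ?_, fun z hz ↦ ?_⟩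
  · simpa [dist_eq_norm] using hκ.dist_le_mul z z'
  · exact (Metric.ball_subset_closedBall.trans (Metric.closedBall_subset_closedBall
      (by linarith))).trans hεO
  · have : ρ z = 1 := ρ.one_of_mem_closedBall (Metric.ball_subset_closedBall hz)
    simp [Ω, this]

end Lifts

/-! ### Parallel transport inside one chart. -/

section LocalTransport

variable {EC : Type*} [NormedAddCommGroup EC] [NormedSpace ℝ EC]
  {C : Type*} [TopologicalSpace C] [ChartedSpace EC C]
  {EB : Type*} [NormedAddCommGroup EB] [NormedSpace ℝ EB]
  {B : Type*} [TopologicalSpace B] [ChartedSpace EB B]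
  {EF : Type*} [NormedAddCommGroup EF] [NormedSpace ℝ EF]
  {F : Type*} [TopologicalSpace F] [ChartedSpace EF F] {pr : C → B}

/-- All tangent spaces unfold to the model space, so vectors at equal but not definitionally equal
points can be compared without casts. -/
theorem OneForm.apply_congr (α : OneForm EC C) {p p' : C} (hp : p = p') {v v' : EC} (hv : v = v') :
    α p v = α p' v' := by
  subst hp hv
  rfl

/-- Near the point `q` of the fibre over `γ t`, parallel transport to time `s` is defined, it is
smooth at `q` and its derivative at `q` preserves the kernel of `α`. -/
def IsSmoothFibration.HasContactTransportAt
    (h : IsSmoothFibration (EC := EC) (EB := EB) EF F pr) (α : OneForm EC C) (γ : ℝ → B)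
    (t s : ℝ) (q : h.Fibre (γ t)) : Prop :=
  ∃ m : h.Fibre (γ t) → C,
    (∀ᶠ q' in 𝓝 q, ∃ c, IsLiftOn EB pr α γ c (uIcc t s) ∧ c t = h.incl _ q' ∧ c s = m q') ∧
    ContMDiffAt 𝓘(ℝ, EF) 𝓘(ℝ, EC) ∞ m q ∧
    ∀ v : TangentSpace 𝓘(ℝ, EF) q, h.restrict α _ q v = 0 →
      α (m q) (mfderiv 𝓘(ℝ, EF) 𝓘(ℝ, EC) m q v) = 0

namespace IsFibredChart

variable {ψ : OpenPartialHomeomorph C (EB × EF)} {χ : OpenPartialHomeomorph B EB}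

theorem contMDiffAt_symm_const (hψ : IsFibredChart EC pr ψ χ) {N : Type*}
    [TopologicalSpace N] [ChartedSpace EF N] {f : N → EF} {q : N} {y : EB}
    (hf : ContMDiffAt 𝓘(ℝ, EF) 𝓘(ℝ, EF) ∞ f q) (hz : (y, f q) ∈ ψ.target) :
    ContMDiffAt 𝓘(ℝ, EF) 𝓘(ℝ, EC) ∞ (fun q ↦ ψ.symm (y, f q)) q :=
  (hψ.contMDiffOn_symm.contMDiffAt (ψ.open_target.mem_nhds hz)).comp q
    (contMDiffAt_const.prodMk_space hf)

theorem mfderiv_symm_const (hψ : IsFibredChart EC pr ψ χ) {N : Type*}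
    [TopologicalSpace N] [ChartedSpace EF N] {f : N → EF} {q : N} {y : EB}
    (hf : MDifferentiableAt 𝓘(ℝ, EF) 𝓘(ℝ, EF) f q) (hz : (y, f q) ∈ ψ.target)
    (v : TangentSpace 𝓘(ℝ, EF) q) :
    mfderiv 𝓘(ℝ, EF) 𝓘(ℝ, EC) (fun q ↦ ψ.symm (y, f q)) q v =
      mfderiv 𝓘(ℝ, EB × EF) 𝓘(ℝ, EC) ψ.symm (y, f q)
        ((0, mfderiv 𝓘(ℝ, EF) 𝓘(ℝ, EF) f q v) : EB × EF) := by
  have h1 : HasMFDerivAt 𝓘(ℝ, EF) 𝓘(ℝ, EB × EF) (fun x : EF ↦ (y, x)) (f q)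
      (ContinuousLinearMap.inr ℝ EB EF) :=
    hasMFDerivAt_iff_hasFDerivAt.2 ((hasFDerivAt_const y (f q)).prodMk (hasFDerivAt_id (f q)))
  have h2 := (hψ.mdifferentiable.mdifferentiableAt_symm hz).hasMFDerivAt.comp q
    (h1.comp q hf.hasMFDerivAt)
  exact DFunLike.congr_fun h2.mfderiv v

end IsFibredChart

variable [FiniteDimensional ℝ EC] [FiniteDimensional ℝ EB] [FiniteDimensional ℝ EF]
  [IsManifold 𝓘(ℝ, EC) ∞ C] [IsManifold 𝓘(ℝ, EB) ∞ B] [IsManifold 𝓘(ℝ, EF) ∞ F]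
  {α : OneForm EC C} (h : IsContactFibration (EB := EB) EF F pr α) {γ : ℝ → B}
  (hγ : ContMDiffOn 𝓘(ℝ, ℝ) 𝓘(ℝ, EB) 1 γ (Icc (0 : ℝ) 1))

-- The neighbourhoods `V` and `U` are independent of `t` and `s`, as the later compactness argument
-- requires. The unordered interval also covers transport backwards in time, which provides the
-- inverse.
include h hγ in
theorem IsContactFibration.exists_local_transport {t₀ : ℝ} (ht₀ : t₀ ∈ Icc (0 : ℝ) 1) {p₀ : C}
    (hp₀ : pr p₀ = γ t₀) :
    ∃ V ∈ 𝓝 p₀, ∃ U ∈ 𝓝[Icc 0 1] t₀, ∀ t s, uIcc t s ⊆ U →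
      (∀ c c', IsLiftOn EB pr α γ c (uIcc t s) → IsLiftOn EB pr α γ c' (uIcc t s) →
        MapsTo c (uIcc t s) V → MapsTo c' (uIcc t s) V → c t = c' t → EqOn c c' (uIcc t s)) ∧
      ∀ q : h.fibration.Fibre (γ t), h.fibration.incl _ q ∈ V →
        h.fibration.HasContactTransportAt α γ t s q := by
  have hpr : MDifferentiable 𝓘(ℝ, EC) 𝓘(ℝ, EB) pr :=
    h.fibration.contMDiff.mdifferentiable (by simp)
  obtain ⟨ψ, χ, hψ, hp⟩ := h.fibration.exists_isFibredChart p₀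
  obtain ⟨A, r, hAs, hr, hAr, hA⟩ := hψ.exists_contactConnection_graph h
  obtain ⟨Ω, κ, M, δ, hΩs, hκ0, hM0, hδ, hκ, hM, hball, hΩA⟩ :=
    exists_bounded_lipschitz_extension ψ.open_target hAs (ψ.map_source hp)
  set y : ℝ → EB := χ ∘ γ with hy
  set η : ℝ → EB := IsFibredChart.chartVelocity χ γ with hη
  set S : Set ℝ := Icc 0 1 ∩ γ ⁻¹' χ.source with hS
  have hψp (p : C) (hp : p ∈ ψ.source) {t : ℝ} (ht : pr p = γ t) : ψ p = (y t, (ψ p).2) :=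
    Prod.ext (by rw [hψ.fst_apply p hp, ht]; rfl) rfl
  have ht₀S : t₀ ∈ S := ⟨ht₀, by rw [mem_preimage, ← hp₀]; exact hψ.mapsTo _ hp⟩
  have hSn : S ∈ 𝓝[Icc 0 1] t₀ := Filter.inter_mem self_mem_nhdsWithin
    ((hγ.continuousOn t₀ ht₀).preimage_mem_nhdsWithin (χ.open_source.mem_nhds ht₀S.2))
  have hyc : ContinuousOn y S := (hψ.contDiffOn_base (k := 1) hγ).continuousOn
  have hηc : ContinuousOn η S := hψ.continuousOn_chartVelocity hγ
  set R : ℝ := ‖η t₀‖ + 1 with hR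
  have hR0 : 0 < R := by positivity
  -- the length of the time interval
  obtain ⟨τ, hτ, hτ1, hτ2⟩ : ∃ τ : ℝ, 0 < τ ∧ 2 * τ * (κ * R) ≤ 1 / 2 ∧
      M * R * (2 * τ) < δ / 2 := by
    -- The first bound makes the Picard operator invertible. The second keeps solutions that start
    -- in the ball of radius `δ / 2` inside the ball of radius `δ`, where `Ω = A`. The summands `+
    -- 1` keep the denominators positive.
    refine ⟨min (1 / (4 * (κ * R + 1))) (δ / (8 * (M * R + 1))), by positivity, ?_, ?_⟩
    · have h1 : 2 * min (1 / (4 * (κ * R + 1))) (δ / (8 * (M * R + 1))) * (κ * R) ≤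
          2 * (1 / (4 * (κ * R + 1))) * (κ * R) := by
        gcongr
        exact min_le_left _ _
      refine h1.trans ?_
      rw [show 2 * (1 / (4 * (κ * R + 1))) * (κ * R) = (κ * R) / (2 * (κ * R + 1)) by
        field_simp; ring, div_le_iff₀ (by positivity)]
      nlinarith [mul_nonneg hκ0 hR0.le]
    · have h1 : M * R * (2 * min (1 / (4 * (κ * R + 1))) (δ / (8 * (M * R + 1)))) ≤
          M * R * (2 * (δ / (8 * (M * R + 1)))) := by
        gcongr
        exact min_le_right _ _
      refine h1.trans_lt ?_
      rw [show M * R * (2 * (δ / (8 * (M * R + 1)))) = (M * R * δ) / (4 * (M * R + 1)) by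
        field_simp; ring, div_lt_iff₀ (by positivity)]
      nlinarith [mul_nonneg hM0 hR0.le, mul_nonneg (mul_nonneg hM0 hR0.le) hδ.le]
  have hz₀ : ψ p₀ = (y t₀, (ψ p₀).2) := hψp p₀ hp hp₀
  set V : Set C := ψ.source ∩ ψ ⁻¹' Metric.ball (ψ p₀) (δ / 2) with hV
  have hVn : V ∈ 𝓝 p₀ := Filter.inter_mem (ψ.open_source.mem_nhds hp)
    ((ψ.continuousAt hp).preimage_mem_nhds (Metric.ball_mem_nhds _ (by positivity)))
  have hVo : IsOpen V := ψ.isOpen_inter_preimage Metric.isOpen_ball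
  set U : Set ℝ := S ∩ {t | ‖η t‖ ≤ R} ∩ y ⁻¹' Metric.ball (y t₀) δ ∩ Metric.ball t₀ τ with hU
  have hUn : U ∈ 𝓝[Icc 0 1] t₀ := by
    have h1 : 𝓝[Icc 0 1] t₀ ≤ 𝓝[S] t₀ := nhdsWithin_le_of_mem hSn
    have h2 : ∀ᶠ t in 𝓝[S] t₀, ‖η t‖ < R :=
      (hηc t₀ ht₀S).norm.eventually (gt_mem_nhds (lt_add_one _))
    have h3 := (hyc t₀ ht₀S).preimage_mem_nhdsWithin (Metric.ball_mem_nhds (y t₀) hδ)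
    exact Filter.inter_mem (Filter.inter_mem (Filter.inter_mem hSn
      (Filter.mem_of_superset (h1 h2) fun u (hu : ‖η u‖ < R) ↦ hu.le)) (h1 h3))
      (nhdsWithin_le_nhds (Metric.ball_mem_nhds t₀ hτ))
  refine ⟨V, hVn, U, hUn, fun t s hts ↦ ?_⟩
  have hJI : uIcc t s ⊆ Icc 0 1 := fun u hu ↦ (hts hu).1.1.1.1
  have hJS : uIcc t s ⊆ S := fun u hu ↦ (hts hu).1.1.1
  have hχ (u) (hu : u ∈ uIcc t s) : γ u ∈ χ.source := (hJS hu).2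
  have hsmall : (t ⊔ s) - (t ⊓ s) ≤ 2 * τ := by
    have h1 := (hts (show t ⊔ s ∈ uIcc t s from ⟨inf_le_sup, le_rfl⟩)).2
    have h2 := (hts (show t ⊓ s ∈ uIcc t s from ⟨le_rfl, inf_le_sup⟩)).2
    rw [Metric.mem_ball, Real.dist_eq, abs_lt] at h1 h2
    linarith
  have htJ : t ∈ uIcc t s := left_mem_uIcc
  have hsJ : s ∈ uIcc t s := right_mem_uIcc
  obtain ⟨φ, hφ0, hφd, hφs, hφv, hφu⟩ := exists_smooth_flow (a := t ⊓ s) (b := t ⊔ s) ⟨t, htJ⟩ Ω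
    ⟨fun u ↦ y u, continuousOn_iff_continuous_domRestrict.1 (hyc.mono hJS)⟩
    ⟨fun u ↦ η u, continuousOn_iff_continuous_domRestrict.1 (hηc.mono hJS)⟩ hΩs hκ hκ0
    (R := R) (fun u ↦ (hts u.2).1.1.2) hR0.le
    ((mul_le_mul_of_nonneg_right hsmall (mul_nonneg hκ0 hR0.le)).trans hτ1)
  -- `uIcc t s` is by definition `Icc (t ⊓ s) (t ⊔ s)`; the facts about the flow are restated
  -- accordingly.
  replace hφ0 : ∀ x, φ x t = x := hφ0
  replace hφd : ∀ x, ∀ u ∈ uIcc t s,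
    HasDerivWithinAt (φ x) (Ω (y u, φ x u) (η u)) (uIcc t s) u := hφd
  replace hφv : ∀ x v, ∀ u ∈ uIcc t s, HasDerivWithinAt (fun u ↦ fderiv ℝ (fun x ↦ φ x u) x v)
    (fderiv ℝ (fun z ↦ Ω (y u, z) (η u)) (φ x u) (fderiv ℝ (fun x ↦ φ x u) x v))
    (uIcc t s) u := hφv
  replace hφu : ∀ x : ℝ → EF,
    (∀ u ∈ uIcc t s, HasDerivWithinAt x (Ω (y u, x u) (η u)) (uIcc t s) u) →
    ∀ u ∈ uIcc t s, x u = φ (x t) u := hφu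
  have hmem (u) (hu : u ∈ uIcc t s) (x : EF) (hx : x ∈ Metric.ball (ψ p₀).2 δ) :
      (y u, x) ∈ Metric.ball (ψ p₀) δ := by
    rw [hz₀, Metric.mem_ball, Prod.dist_eq, max_lt_iff]
    exact ⟨(hts hu).1.2, hx⟩
  have hstay (x : EF) (hx : x ∈ Metric.ball (ψ p₀).2 (δ / 2)) (u) (hu : u ∈ uIcc t s) :
      (y u, φ x u) ∈ Metric.ball (ψ p₀) δ := by
    refine hmem u hu _ ?_
    have h1 := (convex_uIcc t s).norm_image_sub_le_of_norm_hasDerivWithin_le (C := M * R)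
      (fun u hu ↦ hφd x u hu) (fun u hu ↦ ?_) htJ hu
    · rw [hφ0] at h1
      have h2 : ‖u - t‖ ≤ 2 * τ := by
        refine le_trans ?_ hsmall
        rw [Real.norm_eq_abs, abs_le]
        constructor <;> linarith [hu.1, hu.2, htJ.1, htJ.2]
      have h3 : M * R * ‖u - t‖ ≤ M * R * (2 * τ) := by gcongr
      rw [Metric.mem_ball] at hx ⊢
      rw [← dist_eq_norm] at h1
      linarith [dist_triangle (φ x u) x (ψ p₀).2]
    · exact (ContinuousLinearMap.le_opNorm _ _).trans
        (mul_le_mul (hM _) (hts hu).1.1.2 (norm_nonneg _) hM0)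
  have hVapply {u} (hu : u ∈ uIcc t s) {p : C} (hpV : p ∈ V) (hpu : pr p = γ u) :
      ψ p = (y u, (ψ p).2) ∧ (ψ p).2 ∈ Metric.ball (ψ p₀).2 (δ / 2) := by
    refine ⟨hψp p hpV.1 hpu, ?_⟩
    have := hpV.2
    rw [mem_preimage, Metric.mem_ball, Prod.dist_eq, max_lt_iff] at this
    exact this.2
  constructor
  · intro c c' hc hc' hcV hc'V hcc'
    have key (c : ℝ → C) (hc : IsLiftOn EB pr α γ c (uIcc t s)) (hcV : MapsTo c (uIcc t s) V) :
        EqOn c (fun u ↦ ψ.symm (y u, φ (ψ (c t)).2 u)) (uIcc t s) := by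
      have h1 := hφu (fun u ↦ (ψ (c u)).2) fun u hu ↦ by
        have h2 := hψ.hasDerivWithinAt_of_isLiftOn hpr hA hc hu (hcV hu).1
        have h3 := hVapply hu (hcV hu) (hc u hu).1
        rw [← hΩA (Metric.ball_subset_ball (by linarith) (hcV hu).2), h3.1] at h2
        exact h2
      intro u hu
      change c u = ψ.symm (y u, φ (ψ (c t)).2 u)
      rw [← h1 u hu, ← (hVapply hu (hcV hu) (hc u hu).1).1, ψ.left_inv (hcV hu).1]
    intro u hu
    rw [key c hc hcV hu, key c' hc' hc'V hu, hcc']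
  · intro q hqV
    have hιq := h.fibration.contMDiff_incl (b := γ t)
    have hqV' : ∀ᶠ q' in 𝓝 q, h.fibration.incl _ q' ∈ V :=
      hιq.continuous.continuousAt.eventually (hVo.mem_nhds hqV)
    have hcoord (q' : h.fibration.Fibre (γ t)) (hq' : h.fibration.incl _ q' ∈ V) :=
      hVapply htJ hq' (h.fibration.pr_incl q')
    set ξ : h.fibration.Fibre (γ t) → EF := fun q' ↦ (ψ (h.fibration.incl _ q')).2 with hξ
    have hξs : ContMDiffAt 𝓘(ℝ, EF) 𝓘(ℝ, EF) ∞ ξ q :=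
      (contDiff_snd.contMDiff.contMDiffAt).comp q
        ((hψ.contMDiffOn.contMDiffAt (ψ.open_source.mem_nhds hqV.1)).comp q (hιq q))
    have hξd : MDifferentiableAt 𝓘(ℝ, EF) 𝓘(ℝ, EF) ξ q := hξs.mdifferentiableAt (by simp)
    have hst (u) (hu : u ∈ uIcc t s) := hstay (ξ q) (hcoord q hqV).2 u hu
    have hfs : ContMDiffAt 𝓘(ℝ, EF) 𝓘(ℝ, EF) ∞ (fun q' ↦ φ (ξ q') s) q :=
      ((hφs s hsJ).contMDiff.contMDiffAt).comp q hξs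
    refine ⟨fun q' ↦ ψ.symm (y s, φ (ξ q') s), ?_, ?_, fun v hv ↦ ?_⟩
    · filter_upwards [hqV'] with q' hq'
      refine ⟨fun u ↦ ψ.symm (y u, φ (ξ q') u), ?_, ?_, rfl⟩
      · refine hψ.isLiftOn_of_hasDerivWithinAt hpr hA hγ hJI hχ
          (fun u hu ↦ hball (hstay _ (hcoord q' hq').2 u hu)) fun u hu ↦ ?_
        have h1 := hφd (ξ q') u hu
        rw [hΩA (hstay _ (hcoord q' hq').2 u hu)] at h1
        exact h1
      · change ψ.symm (y t, φ (ξ q') t) = _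
        rw [hφ0, ← (hcoord q' hq').1, ψ.left_inv hq'.1]
    · exact hψ.contMDiffAt_symm_const hfs (hball (hst s hsJ))
    · have hinc : h.fibration.incl (γ t) =ᶠ[𝓝 q] fun q' ↦ ψ.symm (y t, ξ q') := by
        filter_upwards [hqV'] with q' hq'
        rw [← (hcoord q' hq').1, ψ.left_inv hq'.1]
      have hξt : (y t, ξ q) ∈ ψ.target := by
        have := hball (hst t htJ)
        rwa [hφ0] at this
      set w : EF := mfderiv 𝓘(ℝ, EF) 𝓘(ℝ, EF) ξ q v with hw
      have hstart : α.pull ψ.symm (y t, ξ q) (0, w) = 0 := by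
        refine (α.apply_congr hinc.self_of_nhds ?_).symm.trans hv
        have := hψ.mfderiv_symm_const hξd hξt v
        exact (DFunLike.congr_fun hinc.mfderiv_eq v).trans this
      have hchain : mfderiv 𝓘(ℝ, EF) 𝓘(ℝ, EF) (fun q' ↦ φ (ξ q') s) q v =
          fderiv ℝ (fun x ↦ φ x s) (ξ q) w := by
        have h1 : MDifferentiableAt 𝓘(ℝ, EF) 𝓘(ℝ, EF) (fun x ↦ φ x s) (ξ q) :=
          ((hφs s hsJ).contMDiff.contMDiffAt).mdifferentiableAt (by simp)
        have h2 := DFunLike.congr_fun (mfderiv_comp q h1 hξd) v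
        rw [mfderiv_eq_fderiv] at h2
        exact h2
      rw [hψ.mfderiv_symm_const (hfs.mdifferentiableAt (by simp)) (hball (hst s hsJ)), hchain]
      have hw0 : fderiv ℝ (fun x ↦ φ x t) (ξ q) w = w := by
        have : (fun x ↦ φ x t) = id := funext hφ0
        rw [this, fderiv_id]
        rfl
      -- Apply the invariance of the kernel to `w` moved by the derivative of the flow; at time `t`
      -- the flow is the identity, so this starts at `w`.
      refine form_eq_zero_of_variational (β := α.pull ψ.symm) (a := t ⊓ s) (b := t ⊔ s)
        (x := φ (ξ q)) (w := fun u ↦ fderiv ℝ (fun x ↦ φ x u) (ξ q) w)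
        ψ.open_target (h.contactForm.smooth.contDiffOn_pull ψ.open_target hψ.contMDiffOn_symm)
        hAs hr hAr (hηc.mono hJS) (fun u hu ↦ hball (hst u hu))
        (fun u hu ↦ (hψ.hasDerivWithinAt_base hγ (hJI hu) (hχ u hu)).mono hJI)
        (fun u hu ↦ ?_) (fun u hu ↦ ?_) htJ hsJ ?_
      · have h1 := hφd (ξ q) u hu
        rwa [hΩA (hst u hu)] at h1
      · have h1 := hφv (ξ q) w u hu
        -- The variational equation involves a derivative, so `Ω` and `A` must agree near the point
        -- and not merely at it.
        have h2 : (fun x ↦ Ω (y u, x) (η u)) =ᶠ[𝓝 (φ (ξ q) u)] fun x ↦ A (y u, x) (η u) := by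
          have : ∀ᶠ x in 𝓝 (φ (ξ q) u), (y u, x) ∈ Metric.ball (ψ p₀) δ :=
            (Continuous.prodMk_right (y u)).continuousAt.eventually
              (Metric.isOpen_ball.mem_nhds (hst u hu))
          filter_upwards [this] with x hx
          rw [hΩA hx]
        rwa [h2.fderiv_eq] at h1
      · change α.pull ψ.symm (y t, φ (ξ q) t) (0, fderiv ℝ (fun x ↦ φ x t) (ξ q) w) = 0
        rw [hw0, hφ0]
        exact hstart

end LocalTransport

/-! ### Parallel transport along the whole path. -/

section GlobalTransport

theorem eventually_uIcc_subset {U : Set ℝ} {t₀ : Icc (0 : ℝ) 1}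
    (hU : U ∈ 𝓝[Icc 0 1] (t₀ : ℝ)) :
    ∀ᶠ z : Icc (0 : ℝ) 1 × Icc (0 : ℝ) 1 in 𝓝 (t₀, t₀), uIcc (z.1 : ℝ) z.2 ⊆ U := by
  obtain ⟨ε, hε, hεU⟩ := Metric.mem_nhdsWithin_iff.1 hU
  have h1 : ∀ᶠ t : Icc (0 : ℝ) 1 in 𝓝 t₀, (t : ℝ) ∈ Metric.ball (t₀ : ℝ) ε :=
    continuous_subtype_val.continuousAt.eventually (Metric.ball_mem_nhds _ hε)
  rw [nhds_prod_eq]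
  filter_upwards [h1.prod_mk h1] with z hz
  refine Subset.trans (subset_inter ?_ ?_) hεU
  · rw [Real.ball_eq_Ioo] at hz ⊢
    exact ordConnected_Ioo.uIcc_subset hz.1 hz.2
  · exact ordConnected_Icc.uIcc_subset z.1.2 z.2.2

variable {EC : Type*} [NormedAddCommGroup EC] [NormedSpace ℝ EC] [FiniteDimensional ℝ EC]
  {C : Type*} [TopologicalSpace C] [ChartedSpace EC C] [IsManifold 𝓘(ℝ, EC) ∞ C]
  {EB : Type*} [NormedAddCommGroup EB] [NormedSpace ℝ EB] [FiniteDimensional ℝ EB]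
  {B : Type*} [TopologicalSpace B] [ChartedSpace EB B] [IsManifold 𝓘(ℝ, EB) ∞ B]
  {EF : Type*} [NormedAddCommGroup EF] [NormedSpace ℝ EF] [FiniteDimensional ℝ EF]
  {F : Type*} [TopologicalSpace F] [ChartedSpace EF F] [IsManifold 𝓘(ℝ, EF) ∞ F]
  {pr : C → B} {α : OneForm EC C} (h : IsContactFibration (EB := EB) EF F pr α) {γ : ℝ → B}
  (hγ : ContMDiffOn 𝓘(ℝ, ℝ) 𝓘(ℝ, EB) 1 γ (Icc (0 : ℝ) 1))

include h hγ

/-- Horizontal lifts are unique. -/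
theorem IsContactFibration.eqOn_of_isLiftOn [T2Space C] {a b : ℝ} (hab : Icc a b ⊆ Icc 0 1)
    {c c' : ℝ → C} (hc : IsLiftOn EB pr α γ c (Icc a b)) (hc' : IsLiftOn EB pr α γ c' (Icc a b))
    {t : ℝ} (ht : t ∈ Icc a b) (hcc' : c t = c' t) : EqOn c c' (Icc a b) := by
  intro s hs
  -- Whether the two lifts agree is locally constant in time: local uniqueness propagates agreement,
  -- and the Hausdorff property propagates disagreement.
  refine (isPreconnected_Icc.induction₂' (fun t s ↦ (c t = c' t ↔ c s = c' s)) (fun t₀ ht₀ ↦ ?_)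
    (fun x y z _ _ _ hxy hyz ↦ hxy.trans hyz) ht hs).1 hcc'
  have hsymm : (∀ᶠ s in 𝓝[Icc a b] t₀, (c t₀ = c' t₀ ↔ c s = c' s)) →
      ∀ᶠ s in 𝓝[Icc a b] t₀, (c t₀ = c' t₀ ↔ c s = c' s) ∧ (c s = c' s ↔ c t₀ = c' t₀) :=
    fun h ↦ h.mono fun _ hs ↦ ⟨hs, hs.symm⟩
  refine hsymm ?_
  by_cases h0 : c t₀ = c' t₀
  · obtain ⟨V, hV, U, hU, hVU⟩ := h.exists_local_transport hγ (hab ht₀) (hc t₀ ht₀).1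
    have h1 := (hc.continuousOn t₀ ht₀).preimage_mem_nhdsWithin hV
    have h2 := (hc'.continuousOn t₀ ht₀).preimage_mem_nhdsWithin (h0 ▸ hV)
    obtain ⟨ε, hε, hεs⟩ := Metric.mem_nhdsWithin_iff.1
      (Filter.inter_mem (Filter.inter_mem h1 h2) (nhdsWithin_mono _ hab hU))
    filter_upwards [self_mem_nhdsWithin, nhdsWithin_le_nhds (Metric.ball_mem_nhds t₀ hε)]
      with s hs hsε
    have hsub : uIcc t₀ s ⊆ Icc a b := ordConnected_Icc.uIcc_subset ht₀ hs
    have hsub' : uIcc t₀ s ⊆ c ⁻¹' V ∩ c' ⁻¹' V ∩ U := by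
      refine Subset.trans (subset_inter ?_ hsub) hεs
      have := Metric.mem_ball_self (x := t₀) hε
      rw [Real.ball_eq_Ioo] at this hsε ⊢
      exact ordConnected_Ioo.uIcc_subset this hsε
    have := (hVU t₀ s fun u hu ↦ (hsub' hu).2).1 c c' (hc.mono hsub) (hc'.mono hsub)
      (fun u hu ↦ (hsub' hu).1.1) (fun u hu ↦ (hsub' hu).1.2) h0
    exact ⟨fun _ ↦ this right_mem_uIcc, fun _ ↦ h0⟩
  · have h1 : ∀ᶠ s in 𝓝[Icc a b] t₀, (c s, c' s) ∈ (diagonal C)ᶜ :=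
      ((hc.continuousOn t₀ ht₀).prodMk (hc'.continuousOn t₀ ht₀)).eventually
        (isClosed_diagonal.isOpen_compl.mem_nhds h0)
    filter_upwards [h1] with s hs
    exact ⟨fun h ↦ (h0 h).elim, fun h ↦ (hs h).elim⟩

/-- For close times, parallel transport is defined near each point of the fibre. -/
theorem IsContactFibration.eventually_hasContactTransportAt [CompactSpace F] (t₀ : Icc (0 : ℝ) 1) :
    ∀ᶠ z : Icc (0 : ℝ) 1 × Icc (0 : ℝ) 1 in 𝓝 (t₀, t₀), ∀ q : h.fibration.Fibre (γ z.1),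
      h.fibration.HasContactTransportAt α γ z.1 z.2 q := by
  obtain ⟨e, hb, he⟩ := h.fibration.locallyTrivial (γ t₀)
  have hγc : Continuous fun t : Icc (0 : ℝ) 1 ↦ γ t :=
    continuousOn_iff_continuous_domRestrict.1 hγ.continuousOn
  have hbase : ∀ᶠ z : Icc (0 : ℝ) 1 × Icc (0 : ℝ) 1 in 𝓝 (t₀, t₀), γ z.1 ∈ e.baseSet :=
    (hγc.comp continuous_fst).continuousAt.eventually (e.open_baseSet.mem_nhds hb)
  -- Tube lemma over the compact typical fibre: neighbourhoods of times that depend on the point `x`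
  -- are replaced by a single one.
  have key := isCompact_univ.eventually_forall_of_forall_eventually (x₀ := (t₀, t₀)) (K := univ)
    (P := fun (z : Icc (0 : ℝ) 1 × Icc (0 : ℝ) 1) (x : F) ↦ ∀ q : h.fibration.Fibre (γ z.1),
      h.fibration.incl _ q = e.toOpenPartialHomeomorph.symm (γ z.1, x) →
      h.fibration.HasContactTransportAt α γ z.1 z.2 q) fun x _ ↦ by
    have htgt : (γ t₀, x) ∈ e.target := e.mem_target.2 hb
    obtain ⟨V, hV, U, hU, hVU⟩ := h.exists_local_transport hγ t₀.2
      (p₀ := e.toOpenPartialHomeomorph.symm (γ t₀, x)) (e.proj_symm_apply' hb)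
    have h1 : ContinuousAt (fun w : (Icc (0 : ℝ) 1 × Icc (0 : ℝ) 1) × F ↦
        e.toOpenPartialHomeomorph.symm (γ w.1.1, w.2)) ((t₀, t₀), x) := by
      refine ContinuousAt.comp (f := fun w : (Icc (0 : ℝ) 1 × Icc (0 : ℝ) 1) × F ↦ (γ w.1.1, w.2))
        (e.toOpenPartialHomeomorph.symm.continuousAt htgt) ?_
      exact ((hγc.comp (continuous_fst.comp continuous_fst)).prodMk continuous_snd).continuousAt
    have h2 := (continuous_fst.continuousAt (x := ((t₀, t₀), x))).eventually
      (eventually_uIcc_subset hU)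
    filter_upwards [h1.eventually hV, h2] with w hw hwU q hq
    exact (hVU _ _ hwU).2 q (by rw [hq]; exact hw)
  filter_upwards [key, hbase] with z hz hzb q
  refine hz (e (h.fibration.incl _ q)).2 (mem_univ _) q ?_
  rw [← h.fibration.fibreHomeomorph_apply e hzb, ← h.fibration.incl_fibreHomeomorph_symm e hzb,
    Homeomorph.symm_apply_apply]

omit hγ

/-- `m` is the parallel transport from the fibre over `γ t` to the fibre over `γ s`; it is smooth
and its derivative preserves the kernel of `α`. -/
structure IsSmoothFibration.IsContactTransport
    (h : IsSmoothFibration (EC := EC) (EB := EB) EF F pr) (α : OneForm EC C) (γ : ℝ → B) {t s : ℝ}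
    (m : h.Fibre (γ t) → h.Fibre (γ s)) : Prop where
  exists_lift : ∀ q, ∃ c, IsLiftOn EB pr α γ c (uIcc t s) ∧ c t = h.incl _ q ∧ c s = h.incl _ (m q)
  contMDiff : ContMDiff 𝓘(ℝ, EF) 𝓘(ℝ, EF) ∞ m
  map_ker : ∀ q (v : TangentSpace 𝓘(ℝ, EF) q), h.restrict α _ q v = 0 →
    h.restrict α _ (m q) (mfderiv 𝓘(ℝ, EF) 𝓘(ℝ, EF) m q v) = 0

include hγ

/-- The local transports need no compatibility assumption: lifts are unique, so a map chosen
pointwise agrees near each point with a smooth local one and inherits its properties. -/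
theorem IsContactFibration.exists_isContactTransport_of_forall [T2Space C] {t s : ℝ}
    (ht : t ∈ Icc (0 : ℝ) 1)
    (hs : s ∈ Icc (0 : ℝ) 1) (hts : ∀ q, h.fibration.HasContactTransportAt α γ t s q) :
    ∃ m : h.fibration.Fibre (γ t) → h.fibration.Fibre (γ s),
      h.fibration.IsContactTransport α γ m := by
  have hJ : uIcc t s ⊆ Icc 0 1 := ordConnected_Icc.uIcc_subset ht hs
  have hex (q : h.fibration.Fibre (γ t)) : ∃ r : h.fibration.Fibre (γ s), ∃ c,
      IsLiftOn EB pr α γ c (uIcc t s) ∧ c t = h.fibration.incl _ q ∧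
        c s = h.fibration.incl _ r := by
    obtain ⟨m, hm, -⟩ := hts q
    obtain ⟨c, hc, hct, -⟩ := hm.self_of_nhds
    exact ⟨⟨c s, (hc s right_mem_uIcc).1⟩, c, hc, hct, rfl⟩
  choose m hm using hex
  have hinc (q) : ∃ m' : h.fibration.Fibre (γ t) → C, h.fibration.incl _ ∘ m =ᶠ[𝓝 q] m' ∧
      ContMDiffAt 𝓘(ℝ, EF) 𝓘(ℝ, EC) ∞ m' q ∧
      ∀ v : TangentSpace 𝓘(ℝ, EF) q, h.fibration.restrict α _ q v = 0 →
        α (m' q) (mfderiv 𝓘(ℝ, EF) 𝓘(ℝ, EC) m' q v) = 0 := by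
    obtain ⟨m', h1, h2, h3⟩ := hts q
    refine ⟨m', ?_, h2, h3⟩
    filter_upwards [h1] with q' hq'
    obtain ⟨c, hc, hct, hcs⟩ := hq'
    obtain ⟨c', hc', hct', hcs'⟩ := hm q'
    rw [Function.comp_apply, ← hcs, ← hcs']
    exact h.eqOn_of_isLiftOn hγ hJ hc' hc left_mem_uIcc (hct'.trans hct.symm) right_mem_uIcc
  have hsm (q) : ContMDiffAt 𝓘(ℝ, EF) 𝓘(ℝ, EF) ∞ m q := by
    obtain ⟨m', h1, h2, -⟩ := hinc q
    exact h.fibration.contMDiffAt_of_incl (h2.congr_of_eventuallyEq h1)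
  refine ⟨m, hm, hsm, fun q v hv ↦ ?_⟩
  obtain ⟨m', h1, h2, h3⟩ := hinc q
  rw [h.fibration.restrict_apply]
  refine (α.apply_congr h1.self_of_nhds ?_).trans (h3 v hv)
  have h4 := mfderiv_comp q ((h.fibration.contMDiff_incl (m q)).mdifferentiableAt (by simp))
    ((hsm q).mdifferentiableAt (by simp))
  exact (DFunLike.congr_fun h4 v).symm.trans (DFunLike.congr_fun h1.mfderiv_eq v)

/-- The times need not be ordered, so the two intervals may overlap. The overlap is an interval
containing `s`, where the two lifts agree; by uniqueness they agree on all of it and can be glued,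
then restricted to the interval from `t` to `r`. -/
theorem IsContactFibration.exists_isContactTransport_trans [T2Space C] {t s r : ℝ}
    (ht : t ∈ Icc (0 : ℝ) 1) (hs : s ∈ Icc (0 : ℝ) 1)
    {m : h.fibration.Fibre (γ t) → h.fibration.Fibre (γ s)}
    {n : h.fibration.Fibre (γ s) → h.fibration.Fibre (γ r)}
    (hm : h.fibration.IsContactTransport α γ m) (hn : h.fibration.IsContactTransport α γ n) :
    h.fibration.IsContactTransport α γ (n ∘ m) := by
  refine ⟨fun q ↦ ?_, hn.contMDiff.comp hm.contMDiff, fun q v hv ↦ ?_⟩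
  · obtain ⟨c₁, hc₁, hct₁, hcs₁⟩ := hm.exists_lift q
    obtain ⟨c₂, hc₂, hct₂, hcs₂⟩ := hn.exists_lift (m q)
    have h1 : uIcc t s ⊆ Icc 0 1 := ordConnected_Icc.uIcc_subset ht hs
    have heq : EqOn c₁ c₂ (uIcc t s ∩ uIcc s r) := by
      have hI : uIcc t s ∩ uIcc s r =
        Icc ((t ⊓ s) ⊔ (s ⊓ r)) ((t ⊔ s) ⊓ (s ⊔ r)) := Icc_inter_Icc
      rw [hI]
      refine h.eqOn_of_isLiftOn hγ ?_ (hc₁.mono ?_) (hc₂.mono ?_) (t := s) ?_ ?_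
      · rw [← hI]
        exact inter_subset_left.trans h1
      · rw [← hI]
        exact inter_subset_left
      · rw [← hI]
        exact inter_subset_right
      · rw [← hI]
        exact ⟨right_mem_uIcc, left_mem_uIcc⟩
      · rw [hcs₁, hct₂]
    obtain ⟨c, e₁, e₂, hc⟩ := hc₁.exists_glue h hc₂ isClosed_Icc isClosed_Icc heq
    refine ⟨c, hc.mono uIcc_subset_uIcc_union_uIcc, ?_, ?_⟩
    · rw [e₁ left_mem_uIcc, hct₁]
    · rw [e₂ right_mem_uIcc, hcs₂]
      rfl
  · have h1 := mfderiv_comp q (hn.contMDiff.mdifferentiableAt (by simp) (x := m q))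
      (hm.contMDiff.mdifferentiableAt (by simp) (x := q))
    rw [h1]
    exact hn.map_ker _ _ (hm.map_ker q v hv)

/-- Parallel transport along `γ`. -/
theorem IsContactFibration.exists_isContactTransport [T2Space C] [CompactSpace F] {t s : ℝ}
    (ht : t ∈ Icc (0 : ℝ) 1) (hs : s ∈ Icc (0 : ℝ) 1) :
    ∃ m : h.fibration.Fibre (γ t) → h.fibration.Fibre (γ s),
      h.fibration.IsContactTransport α γ m := by
  have : PreconnectedSpace (Icc (0 : ℝ) 1) := Subtype.preconnectedSpace isPreconnected_Icc
  -- Existence of a transport is a transitive relation that holds both ways between nearby times,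
  -- hence between any two times of a connected interval.
  refine PreconnectedSpace.induction₂' (α := Icc (0 : ℝ) 1)
    (fun t s ↦ ∃ m : h.fibration.Fibre (γ t) → h.fibration.Fibre (γ s),
      h.fibration.IsContactTransport α γ m) (fun t₀ ↦ ?_) ?_ ⟨t, ht⟩ ⟨s, hs⟩
  · have h1 := h.eventually_hasContactTransportAt hγ t₀
    have h2 : ∀ᶠ s : Icc (0 : ℝ) 1 in 𝓝 t₀, ∀ q, h.fibration.HasContactTransportAt α γ t₀ s q :=
      ((Continuous.prodMk_right t₀).continuousAt (x := t₀)).eventually h1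
    have h3 : ∀ᶠ s : Icc (0 : ℝ) 1 in 𝓝 t₀, ∀ q, h.fibration.HasContactTransportAt α γ s t₀ q :=
      ((Continuous.prodMk_left t₀).continuousAt (x := t₀)).eventually h1
    filter_upwards [h2, h3] with s hs2 hs3
    exact ⟨h.exists_isContactTransport_of_forall hγ t₀.2 s.2 hs2,
      h.exists_isContactTransport_of_forall hγ s.2 t₀.2 hs3⟩
  · refine ⟨?_⟩
    rintro x y z ⟨m, hm⟩ ⟨n, hn⟩
    exact ⟨_, h.exists_isContactTransport_trans hγ x.2 y.2 hm hn⟩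

/-- Transport back and forth is the identity. -/
theorem IsContactFibration.transport_transport [T2Space C] {t s : ℝ}
    (ht : t ∈ Icc (0 : ℝ) 1) (hs : s ∈ Icc (0 : ℝ) 1)
    {m : h.fibration.Fibre (γ t) → h.fibration.Fibre (γ s)}
    {n : h.fibration.Fibre (γ s) → h.fibration.Fibre (γ t)}
    (hm : h.fibration.IsContactTransport α γ m) (hn : h.fibration.IsContactTransport α γ n)
    (q) : n (m q) = q := by
  obtain ⟨c₁, hc₁, hct₁, hcs₁⟩ := hm.exists_lift q
  obtain ⟨c₂, hc₂, hct₂, hcs₂⟩ := hn.exists_lift (m q)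
  rw [uIcc_comm] at hc₂
  have h1 : uIcc t s ⊆ Icc 0 1 := ordConnected_Icc.uIcc_subset ht hs
  refine h.fibration.incl_injective ?_
  rw [← hcs₂, ← hct₁]
  exact (h.eqOn_of_isLiftOn hγ h1 hc₁ hc₂ right_mem_uIcc (hcs₁.trans hct₂.symm)
    left_mem_uIcc).symm

end GlobalTransport

/-! ### Regularity of lifts on `[0,1]` and the contactomorphism property. -/

section Monodromy

variable {EC : Type*} [NormedAddCommGroup EC] [NormedSpace ℝ EC] [FiniteDimensional ℝ EC]
  {C : Type*} [TopologicalSpace C] [ChartedSpace EC C] [IsManifold 𝓘(ℝ, EC) ∞ C]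
  {EB : Type*} [NormedAddCommGroup EB] [NormedSpace ℝ EB] [FiniteDimensional ℝ EB]
  {B : Type*} [TopologicalSpace B] [ChartedSpace EB B] [IsManifold 𝓘(ℝ, EB) ∞ B]
  {EF : Type*} [NormedAddCommGroup EF] [NormedSpace ℝ EF] [FiniteDimensional ℝ EF]
  {F : Type*} [TopologicalSpace F] [ChartedSpace EF F] [IsManifold 𝓘(ℝ, EF) ∞ F]
  {pr : C → B} {α : OneForm EC C} (h : IsContactFibration (EB := EB) EF F pr α) {γ : ℝ → B}

include h in
/-- A horizontal lift is as smooth as the path that it lifts. -/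
theorem IsContactFibration.contMDiffOn_of_isLiftOn {k : ℕ∞} (hk : 1 ≤ k)
    (hγ : ContMDiffOn 𝓘(ℝ, ℝ) 𝓘(ℝ, EB) k γ (Icc (0 : ℝ) 1)) {c : ℝ → C}
    (hc : IsLiftOn EB pr α γ c (Icc 0 1)) :
    ContMDiffOn 𝓘(ℝ, ℝ) 𝓘(ℝ, EC) k c (Icc (0 : ℝ) 1) := by
  intro t₀ ht₀
  obtain ⟨ψ, χ, hψ, hp⟩ := h.fibration.exists_isFibredChart (c t₀)
  obtain ⟨A, r, hAs, -, -, hA⟩ := hψ.exists_contactConnection_graph h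
  exact hψ.contMDiffWithinAt_of_isLiftOn (h.fibration.contMDiff.mdifferentiable (by simp)) hA hAs hk
    hγ hc ht₀ hp

omit [FiniteDimensional ℝ EC] [FiniteDimensional ℝ EB] [IsManifold 𝓘(ℝ, EB) ∞ B]
  [FiniteDimensional ℝ EF] [IsManifold 𝓘(ℝ, EF) ∞ F] in
/-- Parallel transport from time `0` to time `1` is given by the endpoints of horizontal lifts. -/
theorem IsSmoothFibration.IsContactTransport.exists_isHorizontalLift
    {m : h.fibration.Fibre (γ 0) → h.fibration.Fibre (γ 1)}
    (hm : h.fibration.IsContactTransport α γ m) (q : h.fibration.Fibre (γ 0)) :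
    ∃ c, IsHorizontalLift EB pr α γ (h.fibration.incl _ q) c ∧ c 1 = h.fibration.incl _ (m q) := by
  obtain ⟨c, hc, hc0, hc1⟩ := hm.exists_lift q
  rw [uIcc_of_le zero_le_one] at hc
  exact ⟨c, h.isHorizontalLift_iff.2 ⟨hc0, hc⟩, hc1⟩

variable [T2Space C] {t s : ℝ} (ht : t ∈ Icc (0 : ℝ) 1) (hs : s ∈ Icc (0 : ℝ) 1)
  (hγ : ContMDiffOn 𝓘(ℝ, ℝ) 𝓘(ℝ, EB) 1 γ (Icc (0 : ℝ) 1))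
  {m : h.fibration.Fibre (γ t) → h.fibration.Fibre (γ s)}
  {n : h.fibration.Fibre (γ s) → h.fibration.Fibre (γ t)}
  (hm : h.fibration.IsContactTransport α γ m) (hn : h.fibration.IsContactTransport α γ n)

include ht hs hγ hm hn in
/-- The derivative of parallel transport maps the kernel of `α` onto the kernel of `α`. -/
theorem IsContactFibration.exists_mfderiv_transport_eq (q : h.fibration.Fibre (γ t))
    (w : TangentSpace 𝓘(ℝ, EF) (m q)) (hw : h.fibration.restrict α _ (m q) w = 0) :
    ∃ v : TangentSpace 𝓘(ℝ, EF) q, h.fibration.restrict α _ q v = 0 ∧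
      mfderiv 𝓘(ℝ, EF) 𝓘(ℝ, EF) m q v = w := by
  have hnm : n (m q) = q := h.transport_transport hγ ht hs hm hn q
  refine ⟨mfderiv 𝓘(ℝ, EF) 𝓘(ℝ, EF) n (m q) w, ?_, ?_⟩
  · exact ((h.fibration.restrict α _).apply_congr hnm.symm rfl).trans (hn.map_ker (m q) w hw)
  · have h1 : m ∘ n = id := funext fun x ↦ h.transport_transport hγ hs ht hn hm x
    -- The base point `n (m q)` equals `q` only propositionally, so the derivative at `q` is moved
    -- there before the chain rule is applied to `m ∘ n = id`.
    have h2 : HasMFDerivAt 𝓘(ℝ, EF) 𝓘(ℝ, EF) m (n (m q)) (mfderiv 𝓘(ℝ, EF) 𝓘(ℝ, EF) m q) := by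
      have h3 {x : h.fibration.Fibre (γ t)} (hx : x = q) :
          HasMFDerivAt 𝓘(ℝ, EF) 𝓘(ℝ, EF) m x (mfderiv 𝓘(ℝ, EF) 𝓘(ℝ, EF) m q) := by
        subst hx
        exact (hm.contMDiff.mdifferentiable (by simp) x).hasMFDerivAt
      exact h3 hnm
    have h4 := (h2.comp (m q) (hn.contMDiff.mdifferentiable (by simp) (m q)).hasMFDerivAt).mfderiv
    rw [h1, mfderiv_id] at h4
    exact (DFunLike.congr_fun h4 w).symm

include ht hs hγ hm hn in
theorem IsContactFibration.isFibreContactomorphism_transport :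
    h.fibration.IsFibreContactomorphism α (γ t) (γ s) m := by
  let Φ : h.fibration.Fibre (γ t) ≃ₘ^∞⟮𝓘(ℝ, EF), 𝓘(ℝ, EF)⟯ h.fibration.Fibre (γ s) :=
    ⟨⟨m, n, h.transport_transport hγ ht hs hm hn, h.transport_transport hγ hs ht hn hm⟩,
      hm.contMDiff, hn.contMDiff⟩
  refine ⟨⟨Φ, rfl⟩, fun q ↦ ?_⟩
  refine le_antisymm ?_ fun w hw ↦ ?_
  · rintro _ ⟨v, hv, rfl⟩
    exact hm.map_ker q v hv
  · obtain ⟨v, hv, hvw⟩ := h.exists_mfderiv_transport_eq ht hs hγ hm hn q w hw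
    exact ⟨v, hv, hvw⟩

end Monodromy

end

theorem mainTheorem10
    {EC : Type*} [NormedAddCommGroup EC] [NormedSpace ℝ EC] [FiniteDimensional ℝ EC]
    {C : Type*} [TopologicalSpace C] [T2Space C] [ChartedSpace EC C] [IsManifold 𝓘(ℝ, EC) ∞ C]
    {EB : Type*} [NormedAddCommGroup EB] [NormedSpace ℝ EB] [FiniteDimensional ℝ EB]
    {B : Type*} [TopologicalSpace B] [T2Space B] [ChartedSpace EB B] [IsManifold 𝓘(ℝ, EB) ∞ B]
    {EF : Type*} [NormedAddCommGroup EF] [NormedSpace ℝ EF] [FiniteDimensional ℝ EF]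
    {F : Type*} [TopologicalSpace F] [CompactSpace F] [ChartedSpace EF F]
    [IsManifold 𝓘(ℝ, EF) ∞ F]
    (pr : C → B) (α : OneForm EC C)
    (h : IsContactFibration (EB := EB) EF F pr α) :
    (∀ k : ℕ∞, 1 ≤ k → ∀ γ : ℝ → B,
      ContMDiffOn 𝓘(ℝ, ℝ) 𝓘(ℝ, EB) k γ (Icc (0 : ℝ) 1) →
      ∀ p₀ : C, pr p₀ = γ 0 →
        ∃ c : ℝ → C, ContMDiffOn 𝓘(ℝ, ℝ) 𝓘(ℝ, EC) k c (Icc (0 : ℝ) 1) ∧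
          IsHorizontalLift EB pr α γ p₀ c ∧
          ∀ c' : ℝ → C, IsHorizontalLift EB pr α γ p₀ c' → EqOn c' c (Icc (0 : ℝ) 1)) ∧
    (∀ γ : ℝ → B, IsImmersedPath EB γ →
      ∃ m : pr ⁻¹' {γ 0} → pr ⁻¹' {γ 1},
        (∀ p : pr ⁻¹' {γ 0}, ∃ c : ℝ → C,
          IsHorizontalLift EB pr α γ p c ∧ c 1 = (m p : C)) ∧
        h.fibration.IsFibreContactomorphism α (γ 0) (γ 1) m) := by
  have h0 : (0 : ℝ) ∈ Icc (0 : ℝ) 1 := left_mem_Icc.2 zero_le_one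
  have h1 : (1 : ℝ) ∈ Icc (0 : ℝ) 1 := right_mem_Icc.2 zero_le_one
  refine ⟨fun k hk γ hγ p₀ hp₀ ↦ ?_, fun γ hγ ↦ ?_⟩
  · have hγ1 : ContMDiffOn 𝓘(ℝ, ℝ) 𝓘(ℝ, EB) 1 γ (Icc (0 : ℝ) 1) :=
      hγ.of_le (by exact_mod_cast hk)
    -- The lift through a single point is read off from the transport of its whole fibre, which is
    -- where compactness guarantees existence up to time `1`.
    obtain ⟨m, hm⟩ := h.exists_isContactTransport hγ1 h0 h1
    obtain ⟨c, hc, -⟩ := hm.exists_isHorizontalLift h ⟨p₀, hp₀⟩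
    obtain ⟨hc0, hcl⟩ := h.isHorizontalLift_iff.1 hc
    refine ⟨c, h.contMDiffOn_of_isLiftOn hk hγ hcl, hc, fun c' hc' ↦ ?_⟩
    obtain ⟨hc0', hcl'⟩ := h.isHorizontalLift_iff.1 hc'
    exact h.eqOn_of_isLiftOn hγ1 Subset.rfl hcl' hcl h0 (hc0'.trans hc0.symm)
  · have hγ1 : ContMDiffOn 𝓘(ℝ, ℝ) 𝓘(ℝ, EB) 1 γ (Icc (0 : ℝ) 1) := hγ.smooth.of_le (by simp)
    obtain ⟨m, hm⟩ := h.exists_isContactTransport hγ1 h0 h1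
    -- Transport back from time `1` to time `0` supplies the smooth inverse.
    obtain ⟨n, hn⟩ := h.exists_isContactTransport hγ1 h1 h0
    exact ⟨m, hm.exists_isHorizontalLift h, h.isFibreContactomorphism_transport h0 h1 hγ1 hm hn⟩
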